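/- Let $\mathbb{E}_x,\mathbb{E}_y$ be finite-dimensional real spaces with duals $\mathbb{E}_x^*,\mathbb{E}_y^*$, let $K\subset\mathbb{E}_x$ be a closed convex cone that contains no straight line, let $K^*=\{s\in\mathbb{E}_x^*:\langle s,x\rangle\ge 0\ \forall x\in K\}$, and let $A:\mathbb{E}_x\to\mathbb{E}_y^*$ be linear and surjective with adjoint $A^*:\mathbb{E}_y\to\mathbb{E}_x^*$, $b\in\mathbb{E}_y^*$, $c\in\mathbb{E}_x^*\setminus\mathrm{Im}(A^*)$. A closed convex function $f$ with open domain, three times continuously differentiable there, is self-concordant if $D^3f(x)[h]^3\le 2\,(D^2f(x)[h]^2)^{3/2}$ for all $x\in\mathrm{dom}\,f$ and all $h$; it is a self-concordant barrier with parameter $\nu\ge1$ if moreover $\langle\nabla f(x),h\rangle^2\le\nu\,D^2f(x)[h]^2$ for all such $x,h$. Let $F$, with $\mathrm{dom}\,F=\mathrm{int}\,K$, be a $\nu$-self-concordant barrier that is logarithmically homogeneous: $F(\tau x)=F(x)-\nu\ln\tau$ for $x\in\mathrm{int}\,K$, $\tau>0$. Let $F_*(s)=\sup_{x\in\mathrm{int}\,K}[-\langle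 s,x\rangle-F(x)]$ for $s\in\mathrm{int}\,K^*$; its gradients are regarded as elements of $\mathbb{E}_x$. Assume that the pair $$\min_{x\in K}\{\langle c,x\rangle: Ax=b\},\qquad \max_{y\in\mathbb{E}_y,\,s\in K^*}\{\langle b,y\rangle: s+A^*y=c\}$$ is strictly feasible: there are $\hat x\in\mathrm{int}\,K$, $\hat s\in\mathrm{int}\,K^*$, $\hat y\in\mathbb{E}_y$ with $A\hat x=b$ and $\hat s+A^*\hat y=c$. Let $\epsilon>0$, $\bar x\in\mathrm{int}\,K$, $\bar s\in\mathrm{int}\,K^*$, $\bar\tau>0$, and for $u=(x,y,\tau)\in\mathbb{E}_x\times\mathbb{E}_y\times\mathbb{R}$ put $\omega(u)=\bar\tau-\langle c,x\rangle+\langle b,y\rangle-\epsilon\tau$ and $$\Phi(u)=F(\bar x+x)+F_*(\bar s+\tau c-A^*y)-\ln\omega(u),$$ $$\mathrm{dom}\,\Phi=\{u:\ \bar x+x\in\mathrm{int}\,K,\ \bar s+\tau c-A^*y\in\mathrm{int}\,K^*,\ \omega(u)>0\}.$$ Then: 1. $\Phi$ is a self-concordant barrier for $\mathrm{dom}\,\Phi$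 with parameter $2\nu+1$. 2. The problem $\min\{\Phi(u):u=(x,y,\tau)\in\mathrm{dom}\,\Phi,\ Ax=\tau b\}$ has a unique solution $u_*=(x_*,y_*,\tau_*)$. 3. There is a unique vector $\lambda_*\in\mathbb{E}_y$ of optimal Lagrange multipliers, that is, a $\lambda_*$ such that $u_*$ minimizes $\Phi(u)+\langle\tau b-Ax,\lambda_*\rangle$ over $u=(x,y,\tau)\in\mathrm{dom}\,\Phi$. With $\omega_*=\omega(u_*)>0$, the following stationarity conditions hold: $$\nabla F(\bar x+x_*)+\tfrac1{\omega_*}c-A^*\lambda_*=0,\qquad -A\nabla F_*(\bar s+\tau_*c-A^*y_*)-\tfrac1{\omega_*}b=0,$$ $$\langle c,\nabla F_*(\bar s+\tau_*c-A^*y_*)\rangle+\tfrac1{\omega_*}\epsilon+\langle b,\lambda_*\rangle=0.$$ 4. The points $$x_\epsilon=-\omega_*\nabla F_*(\bar s+\tau_*c-A^*y_*),\qquad s_\epsilon=-\omega_*\nabla F(\bar x+x_*),\qquad y_\epsilon=\omega_*\lambda_*$$ are strictly feasible, i.e. $x_\epsilon\in\mathrm{int}\,K$, $Ax_\epsilon=b$,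 $s_\epsilon\in\mathrm{int}\,K^*$, $s_\epsilon+A^*y_\epsilon=c$, and their duality gap is exactly $\epsilon$: $$\langle s_\epsilon,x_\epsilon\rangle=\langle c,x_\epsilon\rangle-\langle b,y_\epsilon\rangle=\epsilon.$$ -/

import Mathlib

namespace InfeasibleStart

noncomputable section

section SelfConcordance

variable {E : Type*} [NormedAddCommGroup E] [NormedSpace ℝ E]

/-- `f`, with open domain `D`, is a (closed, convex, three times continuously differentiable)
self-concordant function.  Closedness is closedness of the epigraph; the values of `f` outside
`D` play no role. -/
structure IsSelfConcordant (D : Set E) (f : E → ℝ) : Prop where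
  isOpen_dom : IsOpen D
  convexOn : ConvexOn ℝ D f
  isClosed_epigraph : IsClosed {p : E × ℝ | p.1 ∈ D ∧ f p.1 ≤ p.2}
  contDiffOn : ContDiffOn ℝ 3 f D
  third_le : ∀ x ∈ D, ∀ h : E,
    iteratedFDeriv ℝ 3 f x (fun _ => h) ≤
      2 * (iteratedFDeriv ℝ 2 f x (fun _ => h)) ^ (3 / 2 : ℝ)

/-- `f`, with open domain `D`, is a self-concordant barrier with parameter `ν`. -/
structure IsSelfConcordantBarrier (D : Set E) (f : E → ℝ) (ν : ℝ) : Prop where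
  selfConcordant : IsSelfConcordant D f
  one_le_param : 1 ≤ ν
  sq_fderiv_le : ∀ x ∈ D, ∀ h : E,
    (fderiv ℝ f x h) ^ 2 ≤ ν * iteratedFDeriv ℝ 2 f x (fun _ => h)

/-- `F` is a `ν`-self-concordant logarithmically homogeneous barrier for the cone `K`
(with domain the interior of `K`). -/
structure IsRegularBarrier (K : ProperCone ℝ E) (F : E → ℝ) (ν : ℝ) : Prop where
  barrier : IsSelfConcordantBarrier (interior (K : Set E)) F ν
  log_homogeneous : ∀ x ∈ interior (K : Set E), ∀ τ : ℝ, 0 < τ →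
    F (τ • x) = F x - ν * Real.log τ

end SelfConcordance

section Duality

variable {E : Type*} [NormedAddCommGroup E] [NormedSpace ℝ E] [FiniteDimensional ℝ E]

/-- The dual cone `K* = {s | ⟨s, x⟩ ≥ 0 for all x ∈ K}` in the dual space. -/
def dualCone (K : ProperCone ℝ E) : ProperCone ℝ (StrongDual ℝ E) :=
  ProperCone.dual (topDualPairing ℝ E).flip (K : Set E)

theorem mem_dualCone {K : ProperCone ℝ E} {s : StrongDual ℝ E} :
    s ∈ dualCone K ↔ ∀ x ∈ K, 0 ≤ s x := Iff.rfl

/-- The dual function `F_*(s) = sup {-⟨s, x⟩ - F(x) | x ∈ int K}` of a function `F` with domain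
`int K`; it is only ever used for `s ∈ int K*`. -/
def dualBarrier (K : ProperCone ℝ E) (F : E → ℝ) (s : StrongDual ℝ E) : ℝ :=
  sSup ((fun x : E => -s x - F x) '' interior (K : Set E))

/-- The gradient at `s` of a function `f` on the dual space, as a vector of `E` through the
canonical identification of `E` with its bidual (see `apply_dualGradient`). -/
def dualGradient (f : StrongDual ℝ E → ℝ) (s : StrongDual ℝ E) : E :=
  (topDualPairing ℝ E).flip.toContPerfPair.symm (fderiv ℝ f s)

theorem apply_dualGradient (f : StrongDual ℝ E → ℝ) (s g : StrongDual ℝ E) :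
    g (dualGradient f s) = fderiv ℝ f s g := by
  have h := (topDualPairing ℝ E).flip.toContPerfPair.apply_symm_apply (fderiv ℝ f s)
  exact DFunLike.congr_fun h g

end Duality

section Problem

variable {Ex Ey : Type*}
  [NormedAddCommGroup Ex] [NormedSpace ℝ Ex] [FiniteDimensional ℝ Ex]
  [NormedAddCommGroup Ey] [NormedSpace ℝ Ey]

/-- `(x, s, y)` is strictly feasible for the primal-dual pair
`min {⟨c, x⟩ | A x = b, x ∈ K}`, `max {⟨b, y⟩ | s + A* y = c, s ∈ K*}`.
The adjoint `A* : Ey → Ex*` of `A : Ex → Ey*` is `A.flip`. -/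
structure IsStrictlyFeasible (K : ProperCone ℝ Ex) (A : Ex →L[ℝ] StrongDual ℝ Ey)
    (b : StrongDual ℝ Ey) (c : StrongDual ℝ Ex) (x : Ex) (s : StrongDual ℝ Ex) (y : Ey) :
    Prop where
  primal_mem : x ∈ interior (K : Set Ex)
  primal_eq : A x = b
  dual_mem : s ∈ interior (dualCone K : Set (StrongDual ℝ Ex))
  dual_eq : s + A.flip y = c

/-- The data of the auxiliary problem: the cone, its barrier, the operator, the right-hand side,
the cost, the accuracy and the reference points.  It carries no assumptions. -/
structure ShiftData (Ex Ey : Type*) [NormedAddCommGroup Ex] [NormedSpace ℝ Ex]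
    [NormedAddCommGroup Ey] [NormedSpace ℝ Ey] where
  K : ProperCone ℝ Ex
  F : Ex → ℝ
  A : Ex →L[ℝ] StrongDual ℝ Ey
  b : StrongDual ℝ Ey
  c : StrongDual ℝ Ex
  ε : ℝ
  xbar : Ex
  sbar : StrongDual ℝ Ex
  τbar : ℝ

namespace ShiftData

variable (P : ShiftData Ex Ey)

/-- The shifted primal point `x̄ + x`, for `u = (x, y, τ)`. -/
def primalPt (u : Ex × Ey × ℝ) : Ex := P.xbar + u.1

/-- The shifted dual point `s̄ + τ c - A* y`, for `u = (x, y, τ)`. -/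
def dualPt (u : Ex × Ey × ℝ) : StrongDual ℝ Ex := P.sbar + u.2.2 • P.c - P.A.flip u.2.1

/-- `ω(u) = τ̄ - ⟨c, x⟩ + ⟨b, y⟩ - ε τ`, for `u = (x, y, τ)`. -/
def omega (u : Ex × Ey × ℝ) : ℝ := P.τbar - P.c u.1 + P.b u.2.1 - P.ε * u.2.2

/-- The domain of `Φ`. -/
def dom : Set (Ex × Ey × ℝ) :=
  {u | P.primalPt u ∈ interior (P.K : Set Ex) ∧
    P.dualPt u ∈ interior (dualCone P.K : Set (StrongDual ℝ Ex)) ∧ 0 < P.omega u}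

/-- `Φ(u) = F(x̄ + x) + F_*(s̄ + τ c - A* y) - ln(τ̄ - ⟨c, x⟩ + ⟨b, y⟩ - ε τ)`. -/
def Phi (u : Ex × Ey × ℝ) : ℝ :=
  P.F (P.primalPt u) + dualBarrier P.K P.F (P.dualPt u) - Real.log (P.omega u)

/-- The feasible set of the auxiliary problem: points of `dom Φ` with `A x = τ b`. -/
def feasible : Set (Ex × Ey × ℝ) := {u | u ∈ P.dom ∧ P.A u.1 = u.2.2 • P.b}

/-- `u` is an optimal solution of `min {Φ(u) | A x = τ b}`. -/
def IsSolution (u : Ex × Ey × ℝ) : Prop := u ∈ P.feasible ∧ IsMinOn P.Phi P.feasible u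

/-- The Lagrange function `L(u, lam) = Φ(u) + ⟨τ b - A x, lam⟩`. -/
def lagrangian (u : Ex × Ey × ℝ) (lam : Ey) : ℝ :=
  P.Phi u + (u.2.2 • P.b - P.A u.1) lam

/-- `lam` is a vector of optimal Lagrange multipliers for the solution `u`: `u` minimizes the
Lagrange function `L(·, lam)` over the domain of `Φ`. -/
def IsMultiplier (u : Ex × Ey × ℝ) (lam : Ey) : Prop :=
  IsMinOn (fun v => P.lagrangian v lam) P.dom u

/-- `∇F_*` at the shifted dual point of `u`, a vector of `Ex`. -/
def gradDual (u : Ex × Ey × ℝ) : Ex := dualGradient (dualBarrier P.K P.F) (P.dualPt u)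

/-- `∇F` at the shifted primal point of `u`. -/
def gradPrimal (u : Ex × Ey × ℝ) : StrongDual ℝ Ex := fderiv ℝ P.F (P.primalPt u)

/-- `x_ε = -ω_* ∇F_*(s̄ + τ_* c - A* y_*)`. -/
def xEps (u : Ex × Ey × ℝ) : Ex := -(P.omega u • P.gradDual u)

/-- `s_ε = -ω_* ∇F(x̄ + x_*)`. -/
def sEps (u : Ex × Ey × ℝ) : StrongDual ℝ Ex := -(P.omega u • P.gradPrimal u)

/-- `y_ε = ω_* lam_*`. -/
def yEps (u : Ex × Ey × ℝ) (lam : Ey) : Ey := P.omega u • lam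

/-- The first-order stationarity conditions of the Lagrange function at `(u, lam)`. -/
structure IsStationary (u : Ex × Ey × ℝ) (lam : Ey) : Prop where
  eq_x : P.gradPrimal u + (P.omega u)⁻¹ • P.c - P.A.flip lam = 0
  eq_y : -P.A (P.gradDual u) - (P.omega u)⁻¹ • P.b = 0
  eq_τ : P.c (P.gradDual u) + (P.omega u)⁻¹ * P.ε + P.b lam = 0

end ShiftData

end Problem

end

end InfeasibleStart

namespace InfeasibleStart

/-! ### Derivatives along lines and under affine substitution. -/

section Calculus

open Set Filter Topology

variable {E G : Type*} [NormedAddCommGroup E] [NormedSpace ℝ E]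
  [NormedAddCommGroup G] [NormedSpace ℝ G]

/-! `Φ` is a sum of three barriers composed with affine maps, with parameters ν, ν and 1, so the
barrier claim reduces to stability of barriers under sums and affine substitution and to the fact
that `F_*` is a ν-barrier for `K*` (`dualBarrier_barrier`). The latter holds because the gradients
of `F` and `F_*` are inverse up to sign: with `∇F(x) = -s` and `∇²F(x) w = -h`, the second and third
differentials of `F_*` at `s` along `h` are those of `F` at `x` along `w`, with a sign change in the
third (`conj_derivatives`). Closedness of `F_*` needs a separate argument: `F` is unbounded below
along rays in directions of `K` (`exists_lt_on_ray`).

A minimizer exists because the feasible set is bounded (`isBounded_feasible`). An asymptotic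
direction (dx, dy, t) satisfies dx ∈ K, q = t c - A* dy ∈ K*, A dx = t b and ⟨c, dx⟩ - ⟨b, dy⟩ ≤ -ε
t, while 0 ≤ ⟨q, dx⟩ = t (⟨c, dx⟩ - ⟨b, dy⟩). The sign t > 0 contradicts ε > 0; strict feasibility
excludes t < 0 and, with c ∉ Im A*, forces the direction to vanish when t = 0. Uniqueness is strict
convexity: the Hessian of `F` controls x, and that of `F_*` controls τ c - A* y, which determines
(y, τ).

At the minimizer, the differential of `Φ` vanishes on the kernel of (x, y, τ) ↦ A x - τ b, hence
factors through this surjective map, which gives a multiplier; it is unique since A* is injective.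
Multiplying the stationarity equations by ω gives primal feasibility, dual feasibility and gap ε. -/

theorem iteratedFDeriv_two_diag (f : E → ℝ) (x h : E) :
    iteratedFDeriv ℝ 2 f x (fun _ => h) = fderiv ℝ (fderiv ℝ f) x h h := by
  rw [iteratedFDeriv_two_apply]

theorem iteratedFDeriv_three_diag (f : E → ℝ) (x h : E) :
    iteratedFDeriv ℝ 3 f x (fun _ => h) = fderiv ℝ (fderiv ℝ (fderiv ℝ f)) x h h h := by
  rw [iteratedFDeriv_succ_apply_right, iteratedFDeriv_two_apply]
  rfl

theorem hasDerivAt_add_smul (x h : E) (t : ℝ) : HasDerivAt (fun t : ℝ => x + t • h) h t := by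
  simpa using ((hasDerivAt_id t).smul_const h).const_add x

theorem hasDerivAt_comp_line {f : E → G} {x h : E} {t : ℝ}
    (hf : DifferentiableAt ℝ f (x + t • h)) :
    HasDerivAt (fun t : ℝ => f (x + t • h)) (fderiv ℝ f (x + t • h) h) t :=
  hf.hasFDerivAt.comp_hasDerivAt t (hasDerivAt_add_smul x h t)

theorem hasDerivAt_clm_apply {c : ℝ → E →L[ℝ] G} {c' : E →L[ℝ] G} {t : ℝ}
    (hc : HasDerivAt c c' t) (h : E) : HasDerivAt (fun t => c t h) (c' h) t := by
  simpa using hc.clm_apply (hasDerivAt_const t h)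

theorem contDiffAt_fderiv {f : E → G} {x : E} {n : ℕ} (hf : ContDiffAt ℝ (n + 1 : ℕ) f x) :
    ContDiffAt ℝ n (fderiv ℝ f) x :=
  hf.fderiv_right (by norm_cast)

theorem differentiableAt_fderiv {f : E → G} {x : E} (hf : ContDiffAt ℝ 2 f x) :
    DifferentiableAt ℝ (fderiv ℝ f) x :=
  (hf.fderiv_right (m := 1) (by norm_num)).differentiableAt (by norm_num)

theorem differentiableAt_fderiv_fderiv {f : E → G} {x : E} (hf : ContDiffAt ℝ 3 f x) :
    DifferentiableAt ℝ (fderiv ℝ (fderiv ℝ f)) x :=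
  differentiableAt_fderiv (hf.fderiv_right (by norm_num))

theorem fderiv_fderiv_symm {f : E → ℝ} {x : E} (hf : ContDiffAt ℝ 2 f x) (h k : E) :
    fderiv ℝ (fderiv ℝ f) x h k = fderiv ℝ (fderiv ℝ f) x k h :=
  (hf.isSymmSndFDerivAt (by simp)) h k

/-- The first derivative of `f` along a line has the Hessian as its derivative. -/
theorem hasDerivAt_fderiv_line {f : E → ℝ} {x h : E} {t : ℝ}
    (hf : ContDiffAt ℝ 2 f (x + t • h)) (k : E) :
    HasDerivAt (fun t : ℝ => fderiv ℝ f (x + t • h) k)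
      (fderiv ℝ (fderiv ℝ f) (x + t • h) h k) t := by
  have := (hasDerivAt_comp_line (differentiableAt_fderiv hf)).clm_apply (hasDerivAt_const t k)
  simpa using this

/-- The second derivative of `f` along a line has the third differential as its derivative. -/
theorem hasDerivAt_hessian_line {f : E → ℝ} {x h : E} {t : ℝ}
    (hf : ContDiffAt ℝ 3 f (x + t • h)) :
    HasDerivAt (fun t : ℝ => fderiv ℝ (fderiv ℝ f) (x + t • h) h h)
      (fderiv ℝ (fderiv ℝ (fderiv ℝ f)) (x + t • h) h h h) t := by
  have h0 : HasDerivAt (fun t : ℝ => fderiv ℝ (fderiv ℝ f) (x + t • h))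
      (fderiv ℝ (fderiv ℝ (fderiv ℝ f)) (x + t • h) h) t :=
    hasDerivAt_comp_line (f := fderiv ℝ (fderiv ℝ f)) (differentiableAt_fderiv_fderiv hf)
  have h1 : HasDerivAt (fun t : ℝ => fderiv ℝ (fderiv ℝ f) (x + t • h) h)
      (fderiv ℝ (fderiv ℝ (fderiv ℝ f)) (x + t • h) h h) t :=
    hasDerivAt_clm_apply h0 h
  exact hasDerivAt_clm_apply h1 h

theorem iteratedFDeriv_comp_affine {D : Set E} (hD : IsOpen D) {f : E → ℝ} {n : ℕ}
    (hf : ContDiffOn ℝ n f D) (L : G →L[ℝ] E) (a : E) {u : G} (hu : L u + a ∈ D) {i : ℕ}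
    (hi : i ≤ n) (m : Fin i → G) :
    iteratedFDeriv ℝ i (fun u => f (L u + a)) u m =
      iteratedFDeriv ℝ i f (L u + a) (fun j => L (m j)) := by
  have hD' : IsOpen ((fun z : E => z + a) ⁻¹' D) := hD.preimage (by fun_prop)
  have hD'' : IsOpen (L ⁻¹' ((fun z : E => z + a) ⁻¹' D)) := hD'.preimage L.continuous
  have hf' : ContDiffOn ℝ n (fun z => f (z + a)) ((fun z : E => z + a) ⁻¹' D) :=
    hf.comp (by fun_prop) (mapsTo_preimage _ _)
  have hin : (i : WithTop ℕ∞) ≤ n := by exact_mod_cast hi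
  have h := L.iteratedFDerivWithin_comp_right hf' hD'.uniqueDiffOn hD''.uniqueDiffOn hu hin
  rw [iteratedFDerivWithin_of_isOpen i hD'' hu, iteratedFDerivWithin_of_isOpen i hD' hu,
    iteratedFDeriv_comp_add_right] at h
  exact DFunLike.congr_fun h m

theorem fderiv_comp_affine {f : E → ℝ} (L : G →L[ℝ] E) (a : E) {u : G}
    (hf : DifferentiableAt ℝ f (L u + a)) :
    fderiv ℝ (fun u => f (L u + a)) u = (fderiv ℝ f (L u + a)).comp L :=
  (hf.hasFDerivAt.comp u (L.hasFDerivAt.add_const a)).fderiv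

end Calculus

/-! ### First- and second-order conditions for convexity. -/

section Convexity

open Set Filter Topology

variable {E : Type*} [NormedAddCommGroup E] [NormedSpace ℝ E]

/-- The gradient inequality for convex functions. -/
theorem add_fderiv_le_of_convexOn {D : Set E} {f : E → ℝ} (hf : ConvexOn ℝ D f) {x y : E}
    (hx : x ∈ D) (hy : y ∈ D) (hd : DifferentiableAt ℝ f x) :
    f x + fderiv ℝ f x (y - x) ≤ f y := by
  have hg : ConvexOn ℝ ((AffineMap.lineMap x y : ℝ →ᵃ[ℝ] E) ⁻¹' D)
      (f ∘ (AffineMap.lineMap x y : ℝ →ᵃ[ℝ] E)) := hf.comp_affineMap _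
  have hder : HasDerivAt (f ∘ (AffineMap.lineMap x y : ℝ →ᵃ[ℝ] E)) (fderiv ℝ f x (y - x)) 0 := by
    have h0 : HasFDerivAt f (fderiv ℝ f x) ((AffineMap.lineMap x y : ℝ →ᵃ[ℝ] E) 0) := by
      simpa using hd.hasFDerivAt
    exact h0.comp_hasDerivAt 0 AffineMap.hasDerivAt_lineMap
  have := hg.le_slope_of_hasDerivAt (x := 0) (y := 1) (by simpa) (by simpa) one_pos hder
  simp [slope_def_field] at this
  rw [map_sub]
  linarith

theorem hessian_nonneg_of_convexOn {D : Set E} (hD : IsOpen D) {f : E → ℝ}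
    (hf : ConvexOn ℝ D f) (hc : ContDiffOn ℝ 2 f D) {x : E} (hx : x ∈ D) (h : E) :
    0 ≤ fderiv ℝ (fderiv ℝ f) x h h := by
  have hat : ∀ y ∈ D, ContDiffAt ℝ 2 f y := fun y hy => hc.contDiffAt (hD.mem_nhds hy)
  have hnear : ∀ᶠ t in 𝓝 (0 : ℝ), x + t • h ∈ D := by
    have : ContinuousAt (fun t : ℝ => x + t • h) 0 := by fun_prop
    exact this.eventually_mem (by simpa using hD.mem_nhds hx)
  have hder := hasDerivAt_fderiv_line (x := x) (h := h) (t := 0) (by simpa using hat x hx) h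
  simp only [zero_smul, add_zero] at hder
  refine ge_of_tendsto (hasDerivAt_iff_tendsto_slope.1 hder)
    ((eventually_nhdsWithin_of_eventually_nhds hnear).mp ?_)
  filter_upwards [self_mem_nhdsWithin] with t ht htD
  have h1 := add_fderiv_le_of_convexOn hf hx htD ((hat x hx).differentiableAt (by norm_num))
  have h2 := add_fderiv_le_of_convexOn hf htD hx ((hat _ htD).differentiableAt (by norm_num))
  simp only [add_sub_cancel_left, sub_add_cancel_left, map_smul, map_neg, smul_eq_mul] at h1 h2
  -- Adding the gradient inequalities at both ends shows that the derivative is monotone along the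
  -- line; the Hessian is the limit of its slopes.
  have h3 : 0 ≤ t * (fderiv ℝ f (x + t • h) h - fderiv ℝ f x h) := by linarith
  have ht' : t ≠ 0 := ht
  rw [slope_def_field]
  simp only [zero_smul, add_zero, sub_zero]
  have : (fderiv ℝ f (x + t • h) h - fderiv ℝ f x h) / t =
      t * (fderiv ℝ f (x + t • h) h - fderiv ℝ f x h) / t ^ 2 := by field_simp
  rw [this]
  positivity

theorem strictConvexOn_of_hessian_pos {D : Set E} (hD : IsOpen D) (hconv : Convex ℝ D)
    {f : E → ℝ} (hc : ContDiffOn ℝ 2 f D)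
    (hpos : ∀ x ∈ D, ∀ h : E, h ≠ 0 → 0 < iteratedFDeriv ℝ 2 f x (fun _ => h)) :
    StrictConvexOn ℝ D f := by
  have hat : ∀ y ∈ D, ContDiffAt ℝ 2 f y := fun y hy => hc.contDiffAt (hD.mem_nhds hy)
  refine ⟨hconv, fun x hx y hy hxy a b ha hb hab => ?_⟩
  have hcont : Continuous (fun t : ℝ => x + t • (y - x)) := by fun_prop
  have hseg : ∀ t ∈ Icc (0 : ℝ) 1, x + t • (y - x) ∈ D := fun t ht =>
    hconv.add_smul_sub_mem hx hy ht
  have hstrict : StrictConvexOn ℝ (Icc 0 1) (fun t : ℝ => f (x + t • (y - x))) := by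
    refine strictConvexOn_of_deriv2_pos (convex_Icc 0 1) ?_ ?_
    · intro t ht
      exact ((hat _ (hseg t ht)).continuousAt.comp
        (f := fun t : ℝ => x + t • (y - x)) hcont.continuousAt).continuousWithinAt
    · intro t ht
      rw [interior_Icc] at ht
      have htD := hseg t (Ioo_subset_Icc_self ht)
      have hev : deriv (fun t : ℝ => f (x + t • (y - x))) =ᶠ[𝓝 t]
          fun t => fderiv ℝ f (x + t • (y - x)) (y - x) := by
        filter_upwards [hcont.continuousAt.eventually_mem (hD.mem_nhds htD)] with s hs
        exact (hasDerivAt_comp_line ((hat _ hs).differentiableAt (by norm_num))).deriv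
      simp only [Function.iterate_succ, Function.iterate_zero, Function.comp_def, id]
      rw [hev.deriv_eq, (hasDerivAt_fderiv_line (hat _ htD) _).deriv]
      rw [← iteratedFDeriv_two_diag]
      exact hpos _ htD _ (sub_ne_zero.2 hxy.symm)
  have := hstrict.2 (left_mem_Icc.2 zero_le_one) (right_mem_Icc.2 zero_le_one) zero_ne_one
    ha hb hab
  have hpt : x + b • (y - x) = a • x + b • y := by
    rw [← eq_sub_iff_add_eq] at hab; subst hab; module
  simpa [hpt] using this

end Convexity

/-! ### Sums, affine substitutions, and the logarithm. -/

section SelfConcordantCalculus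

open Set Filter Topology

variable {E G : Type*} [NormedAddCommGroup E]

theorem closure_sublevel_subset_of_isClosed_epigraph {D : Set E} {f : E → ℝ}
    (h : IsClosed {p : E × ℝ | p.1 ∈ D ∧ f p.1 ≤ p.2}) (M : ℝ) :
    closure {x | x ∈ D ∧ f x ≤ M} ⊆ {x | x ∈ D ∧ f x ≤ M} :=
  (h.preimage (f := fun x : E => (x, M)) (by fun_prop)).closure_subset

/-- A continuous function on an open set has a closed epigraph as soon as its sublevel sets do not
accumulate at the boundary of the domain. -/
theorem isClosed_epigraph_of_closure_sublevel {D : Set E} (hD : IsOpen D) {f : E → ℝ}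
    (hf : ContinuousOn f D) (h : ∀ M, closure {x | x ∈ D ∧ f x ≤ M} ⊆ D) :
    IsClosed {p : E × ℝ | p.1 ∈ D ∧ f p.1 ≤ p.2} := by
  refine IsSeqClosed.isClosed fun p q hp hq => ?_
  have h1 : Tendsto (fun n => (p n).1) atTop (𝓝 q.1) := (continuous_fst.tendsto q).comp hq
  have h2 : Tendsto (fun n => (p n).2) atTop (𝓝 q.2) := (continuous_snd.tendsto q).comp hq
  have hmem : q.1 ∈ D := by
    refine h (q.2 + 1) (mem_closure_of_tendsto h1 ?_)
    filter_upwards [h2.eventually (gt_mem_nhds (lt_add_one q.2))] with n hn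
    exact ⟨(hp n).1, (hp n).2.trans hn.le⟩
  have hc : ContinuousAt f q.1 := hf.continuousAt (hD.mem_nhds hmem)
  exact ⟨hmem, le_of_tendsto_of_tendsto (hc.tendsto.comp h1) h2
    (Eventually.of_forall fun n => (hp n).2)⟩

variable [NormedSpace ℝ E] [NormedAddCommGroup G] [NormedSpace ℝ G]

namespace IsSelfConcordant

variable {D : Set E} {f : E → ℝ}

theorem contDiffAt (hf : IsSelfConcordant D f) {x : E} (hx : x ∈ D) : ContDiffAt ℝ 3 f x :=
  hf.contDiffOn.contDiffAt (hf.isOpen_dom.mem_nhds hx)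

theorem contDiffAt_two (hf : IsSelfConcordant D f) {x : E} (hx : x ∈ D) : ContDiffAt ℝ 2 f x :=
  (hf.contDiffAt hx).of_le (by norm_num)

theorem differentiableAt (hf : IsSelfConcordant D f) {x : E} (hx : x ∈ D) :
    DifferentiableAt ℝ f x :=
  (hf.contDiffAt hx).differentiableAt (by norm_num)

theorem hessian_nonneg (hf : IsSelfConcordant D f) {x : E} (hx : x ∈ D) (h : E) :
    0 ≤ fderiv ℝ (fderiv ℝ f) x h h :=
  hessian_nonneg_of_convexOn hf.isOpen_dom hf.convexOn (hf.contDiffOn.of_le (by norm_num)) hx h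

/-- The third differential is odd in h and the right-hand side is even, so the one-sided bound at h
and -h is two-sided. -/
theorem abs_third_le (hf : IsSelfConcordant D f) {x : E} (hx : x ∈ D) (h : E) :
    |fderiv ℝ (fderiv ℝ (fderiv ℝ f)) x h h h| ≤
      2 * (fderiv ℝ (fderiv ℝ f) x h h) ^ (3 / 2 : ℝ) := by
  have h1 := hf.third_le x hx h
  have h2 := hf.third_le x hx (-h)
  rw [iteratedFDeriv_three_diag, iteratedFDeriv_two_diag] at h1 h2
  simp only [map_neg, neg_apply, neg_neg] at h2
  exact abs_le.2 ⟨by linarith, h1⟩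

theorem add {D₁ D₂ : Set E} {f₁ f₂ : E → ℝ} (h₁ : IsSelfConcordant D₁ f₁)
    (h₂ : IsSelfConcordant D₂ f₂) : IsSelfConcordant (D₁ ∩ D₂) (f₁ + f₂) := by
  have hconv : Convex ℝ (D₁ ∩ D₂) := h₁.convexOn.1.inter h₂.convexOn.1
  have hcd : ContDiffOn ℝ 3 (f₁ + f₂) (D₁ ∩ D₂) :=
    (h₁.contDiffOn.mono inter_subset_left).add (h₂.contDiffOn.mono inter_subset_right)
  -- An affine minorant bounds each summand below near any point, even outside its domain. A bound
  -- on the sum thus bounds each summand from above, and closedness passes to the sum.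
  have lower : ∀ {D : Set E} {f : E → ℝ}, IsSelfConcordant D f → ∀ u : E, ∃ m : ℝ,
      ∀ᶠ x in 𝓝 u, x ∈ D → m ≤ f x := by
    intro D f hf u
    rcases D.eq_empty_or_nonempty with rfl | ⟨z, hz⟩
    · exact ⟨0, by simp⟩
    refine ⟨f z + fderiv ℝ f z (u - z) - 1, ?_⟩
    have hcont : Continuous fun x : E => f z + fderiv ℝ f z (x - z) := by fun_prop
    filter_upwards [hcont.continuousAt.eventually (lt_mem_nhds (sub_one_lt
      (f z + fderiv ℝ f z (u - z))))] with x hx hxD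
    exact hx.le.trans (add_fderiv_le_of_convexOn hf.convexOn hz hxD (hf.differentiableAt hz))
  refine ⟨h₁.isOpen_dom.inter h₂.isOpen_dom, ?_, ?_, hcd, ?_⟩
  · exact (h₁.convexOn.subset inter_subset_left hconv).add
      (h₂.convexOn.subset inter_subset_right hconv)
  · refine isClosed_epigraph_of_closure_sublevel (h₁.isOpen_dom.inter h₂.isOpen_dom)
      hcd.continuousOn fun M u hu => ?_
    rw [mem_closure_iff_frequently] at hu
    obtain ⟨m₁, hm₁⟩ := lower h₁ u
    obtain ⟨m₂, hm₂⟩ := lower h₂ u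
    constructor
    · refine (closure_sublevel_subset_of_isClosed_epigraph h₁.isClosed_epigraph (M - m₂)
        (mem_closure_iff_frequently.2 ((hu.and_eventually hm₂).mono ?_))).1
      rintro x ⟨⟨⟨hx1, hx2⟩, hx3⟩, hx4⟩
      have := hx4 hx2
      exact ⟨hx1, by simp only [Pi.add_apply] at hx3; linarith⟩
    · refine (closure_sublevel_subset_of_isClosed_epigraph h₂.isClosed_epigraph (M - m₁)
        (mem_closure_iff_frequently.2 ((hu.and_eventually hm₁).mono ?_))).1
      rintro x ⟨⟨⟨hx1, hx2⟩, hx3⟩, hx4⟩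
      have := hx4 hx1
      exact ⟨hx2, by simp only [Pi.add_apply] at hx3; linarith⟩
  · rintro x ⟨hx1, hx2⟩ h
    rw [iteratedFDeriv_add_apply (h₁.contDiffAt hx1) (h₂.contDiffAt hx2),
      iteratedFDeriv_add_apply (h₁.contDiffAt_two hx1) (h₂.contDiffAt_two hx2)]
    have k1 := h₁.third_le x hx1 h
    have k2 := h₂.third_le x hx2 h
    -- Superadditivity of t ↦ t^(3/2) keeps the constant 2.
    have k3 := Real.add_rpow_le_rpow_add (h₁.hessian_nonneg hx1 h) (h₂.hessian_nonneg hx2 h)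
      (p := 3 / 2) (by norm_num)
    simp only [← iteratedFDeriv_two_diag] at k3
    simp only [add_apply]
    linarith

theorem comp_affine (hf : IsSelfConcordant D f) (L : G →L[ℝ] E) (a : E) :
    IsSelfConcordant {u | L u + a ∈ D} (fun u => f (L u + a)) := by
  have hcont : Continuous fun u : G => L u + a := by fun_prop
  have hopen : IsOpen {u | L u + a ∈ D} := hf.isOpen_dom.preimage hcont
  have hcd : ContDiffOn ℝ 3 (fun u => f (L u + a)) {u | L u + a ∈ D} :=
    hf.contDiffOn.comp (L.contDiff.add contDiff_const).contDiffOn fun u hu => hu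
  refine ⟨hopen, ?_, ?_, hcd, ?_⟩
  · exact hf.convexOn.comp_affineMap ((L : G →ₗ[ℝ] E).toAffineMap + AffineMap.const ℝ G a)
  · refine isClosed_epigraph_of_closure_sublevel hopen hcd.continuousOn fun M u hu => ?_
    exact (closure_sublevel_subset_of_isClosed_epigraph hf.isClosed_epigraph M
      (map_mem_closure hcont hu fun x hx => hx)).1
  · intro u hu h
    rw [iteratedFDeriv_comp_affine (n := 3) hf.isOpen_dom hf.contDiffOn L a hu le_rfl,
      iteratedFDeriv_comp_affine (n := 3) hf.isOpen_dom hf.contDiffOn L a hu (by norm_num)]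
    exact hf.third_le _ hu (L h)

end IsSelfConcordant

namespace IsSelfConcordantBarrier

theorem add {D₁ D₂ : Set E} {f₁ f₂ : E → ℝ} {ν₁ ν₂ : ℝ} (h₁ : IsSelfConcordantBarrier D₁ f₁ ν₁)
    (h₂ : IsSelfConcordantBarrier D₂ f₂ ν₂) :
    IsSelfConcordantBarrier (D₁ ∩ D₂) (f₁ + f₂) (ν₁ + ν₂) := by
  have n1 := h₁.one_le_param
  have n2 := h₂.one_le_param
  refine ⟨h₁.selfConcordant.add h₂.selfConcordant, by linarith, ?_⟩
  rintro x ⟨hx1, hx2⟩ h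
  rw [iteratedFDeriv_add_apply (h₁.selfConcordant.contDiffAt_two hx1)
    (h₂.selfConcordant.contDiffAt_two hx2), fderiv_add (h₁.selfConcordant.differentiableAt hx1)
    (h₂.selfConcordant.differentiableAt hx2)]
  have k1 := h₁.sq_fderiv_le x hx1 h
  have k2 := h₂.sq_fderiv_le x hx2 h
  have p1 := h₁.selfConcordant.hessian_nonneg hx1 h
  have p2 := h₂.selfConcordant.hessian_nonneg hx2 h
  rw [← iteratedFDeriv_two_diag] at p1 p2
  simp only [add_apply]
  set p := fderiv ℝ f₁ x h
  set q := fderiv ℝ f₂ x h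
  set α := iteratedFDeriv ℝ 2 f₁ x fun _ => h
  set β := iteratedFDeriv ℝ 2 f₂ x fun _ => h
  have hsq : (p * q) ^ 2 ≤ (ν₁ * β) * (ν₂ * α) := by
    rw [mul_pow]
    calc p ^ 2 * q ^ 2 ≤ (ν₁ * α) * (ν₂ * β) := by gcongr
      _ = _ := by ring
  -- The cross term is bounded by the arithmetic-geometric mean inequality, so the parameters simply
  -- add.
  have hpq : 2 * (p * q) ≤ ν₁ * β + ν₂ * α := by
    refine le_of_sq_le_sq ?_ (by positivity)
    nlinarith [sq_nonneg (ν₁ * β - ν₂ * α)]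
  nlinarith

theorem comp_affine {D : Set E} {f : E → ℝ} {ν : ℝ} (hf : IsSelfConcordantBarrier D f ν)
    (L : G →L[ℝ] E) (a : E) :
    IsSelfConcordantBarrier {u | L u + a ∈ D} (fun u => f (L u + a)) ν := by
  refine ⟨hf.selfConcordant.comp_affine L a, hf.one_le_param, fun u hu h => ?_⟩
  rw [iteratedFDeriv_comp_affine (n := 3) hf.selfConcordant.isOpen_dom
    hf.selfConcordant.contDiffOn L a hu (by norm_num),
    fderiv_comp_affine L a (hf.selfConcordant.differentiableAt hu)]
  exact hf.sq_fderiv_le _ hu (L h)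

end IsSelfConcordantBarrier

theorem isSelfConcordantBarrier_neg_log :
    IsSelfConcordantBarrier (Ioi (0 : ℝ)) (fun t => -Real.log t) 1 := by
  have hcd : ContDiffOn ℝ 3 (fun t => -Real.log t) (Ioi (0 : ℝ)) :=
    (Real.contDiffOn_log.mono fun t ht => ne_of_gt ht).neg
  have d1 : ∀ t : ℝ, deriv (fun t => -Real.log t) t = -t⁻¹ := fun t => by
    simp [deriv.fun_neg]
  have d2 : ∀ t : ℝ, deriv (fun t : ℝ => -t⁻¹) t = (t ^ 2)⁻¹ := fun t => by
    simp [deriv.fun_neg]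
  have i2 : ∀ t : ℝ, iteratedDeriv 2 (fun t => -Real.log t) t = (t ^ 2)⁻¹ := fun t => by
    rw [iteratedDeriv_succ, iteratedDeriv_one, funext d1, d2]
  have i3 : ∀ t : ℝ, 0 < t → iteratedDeriv 3 (fun t => -Real.log t) t = -2 * (t ^ 3)⁻¹ :=
      fun t ht => by
    rw [iteratedDeriv_succ, funext i2]
    have := ((hasDerivAt_id t).pow 2).inv (by simpa using ht.ne')
    refine HasDerivAt.deriv (this.congr_deriv ?_)
    simp
    field_simp
  refine ⟨⟨isOpen_Ioi, ?_, ?_, hcd, ?_⟩, le_rfl, ?_⟩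
  · exact strictConcaveOn_log_Ioi.concaveOn.neg
  · refine isClosed_epigraph_of_closure_sublevel isOpen_Ioi hcd.continuousOn fun M => ?_
    refine (closure_minimal (t := Ici (Real.exp (-M))) ?_ isClosed_Ici).trans
      fun t ht => (Real.exp_pos _).trans_le ht
    rintro t ⟨ht, htM⟩
    exact (Real.le_log_iff_exp_le ht).1 (by linarith)
  · intro t ht h
    have ht' : (0 : ℝ) < t := ht
    simp only [iteratedFDeriv_apply_eq_iteratedDeriv_mul_prod, i2, i3 t ht, Finset.prod_const,
      Finset.card_univ, Fintype.card_fin, smul_eq_mul]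
    have e : h ^ 2 * (t ^ 2)⁻¹ = (|h| / t) ^ (2 : ℝ) := by
      rw [Real.rpow_two, div_pow, sq_abs]; rfl
    rw [e, ← Real.rpow_mul (by positivity), show (2 : ℝ) * (3 / 2) = (3 : ℕ) by norm_num,
      Real.rpow_natCast, div_pow]
    have : -h ^ 3 ≤ |h| ^ 3 := by
      rw [← abs_pow]; exact neg_le_abs _
    calc h ^ 3 * (-2 * (t ^ 3)⁻¹) = 2 * (-h ^ 3 / t ^ 3) := by ring
      _ ≤ _ := by gcongr
  · intro t ht h
    have hf : fderiv ℝ (fun t => -Real.log t) t h = -(h * t⁻¹) := by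
      rw [fderiv_eq_smul_deriv, d1]; simp
    simp only [iteratedFDeriv_apply_eq_iteratedDeriv_mul_prod, i2, Finset.prod_const,
      Finset.card_univ, Fintype.card_fin, smul_eq_mul, hf]
    apply le_of_eq; ring

end SelfConcordantCalculus

/-! ### Behaviour of self-concordant functions along lines and rays. -/

section Lines

open Set Filter Topology

variable {E : Type*} [NormedAddCommGroup E] [NormedSpace ℝ E] {D : Set E} {f : E → ℝ}

namespace IsSelfConcordant

/-- A self-concordant function is affine along a direction in which its Hessian degenerates. -/
theorem eq_add_fderiv_of_hessian_eq_zero (hf : IsSelfConcordant D f) {x h : E} (hx : x ∈ D)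
    (hxh : x + h ∈ D) (h0 : fderiv ℝ (fderiv ℝ f) x h h = 0) :
    f (x + h) = f x + fderiv ℝ f x h := by
  have hseg : ∀ t ∈ Icc (0 : ℝ) 1, x + t • h ∈ D := fun t ht => by
    simpa using hf.convexOn.1.add_smul_sub_mem hx hxh ht
  have hg : ∀ t ∈ Icc (0 : ℝ) 1, HasDerivAt (fun t : ℝ => fderiv ℝ (fderiv ℝ f) (x + t • h) h h)
      (fderiv ℝ (fderiv ℝ (fderiv ℝ f)) (x + t • h) h h h) t := fun t ht =>
    hasDerivAt_hessian_line (hf.contDiffAt (hseg t ht))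
  have hgc : ContinuousOn (fun t : ℝ => fderiv ℝ (fderiv ℝ f) (x + t • h) h h) (Icc 0 1) :=
    fun t ht => (hg t ht).continuousAt.continuousWithinAt
  obtain ⟨M, hM⟩ := isCompact_Icc.bddAbove_image hgc
  have hgM : ∀ t ∈ Icc (0 : ℝ) 1, fderiv ℝ (fderiv ℝ f) (x + t • h) h h ≤ M := fun t ht =>
    hM (mem_image_of_mem _ ht)
  have hzero : ∀ t ∈ Icc (0 : ℝ) 1, fderiv ℝ (fderiv ℝ f) (x + t • h) h h = 0 := by
    intro t ht
    -- For g the Hessian along the segment, |g'| ≤ 2 g^(3/2) ≤ 2 √M g, so g(0) = 0 propagates by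
    -- Grönwall.
    have := norm_le_gronwallBound_of_norm_deriv_right_le (δ := 0) (K := 2 * √M) (ε := 0)
      (f' := fun t : ℝ => fderiv ℝ (fderiv ℝ (fderiv ℝ f)) (x + t • h) h h h) hgc
      (fun s hs => (hg s (Ico_subset_Icc_self hs)).hasDerivWithinAt) (by simp [h0]) ?_ t ht
    · simpa [gronwallBound_ε0_δ0] using this
    · intro s hs
      have hs' := Ico_subset_Icc_self hs
      have hnn := hf.hessian_nonneg (hseg s hs') h
      rw [Real.norm_eq_abs, Real.norm_eq_abs, abs_of_nonneg hnn, add_zero]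
      refine (hf.abs_third_le (hseg s hs') h).trans ?_
      rw [show (3 / 2 : ℝ) = 1 / 2 + 1 by norm_num, Real.rpow_add' hnn (by norm_num),
        Real.rpow_one, ← Real.sqrt_eq_rpow, ← mul_assoc]
      gcongr
      exact hgM s hs'
  have hfst : ∀ t ∈ Icc (0 : ℝ) 1, fderiv ℝ f (x + t • h) h = fderiv ℝ f x h := by
    intro t ht
    have hd : ∀ s ∈ Icc (0 : ℝ) 1, HasDerivAt (fun t : ℝ => fderiv ℝ f (x + t • h) h) 0 s :=
      fun s hs => (hasDerivAt_fderiv_line (hf.contDiffAt_two (hseg s hs)) h).congr_deriv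
        (hzero s hs)
    simpa using constant_of_has_deriv_right_zero
      (fun s hs => (hd s hs).continuousAt.continuousWithinAt)
      (fun s hs => (hd s (Ico_subset_Icc_self hs)).hasDerivWithinAt) t ht
  have hd : ∀ s ∈ Icc (0 : ℝ) 1,
      HasDerivAt (fun t : ℝ => f (x + t • h) - t * fderiv ℝ f x h) 0 s := fun s hs => by
    have h1 := hasDerivAt_comp_line (hf.differentiableAt (hseg s hs))
    rw [hfst s hs] at h1
    exact (h1.sub ((hasDerivAt_id s).mul_const (fderiv ℝ f x h))).congr_deriv (by simp)
  have := constant_of_has_deriv_right_zero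
      (fun s hs => (hd s hs).continuousAt.continuousWithinAt)
      (fun s hs => (hd s (Ico_subset_Icc_self hs)).hasDerivWithinAt) 1
      (right_mem_Icc.2 zero_le_one)
  simp at this
  linarith

/-- If the Hessian degenerates in a direction, then the domain contains the whole line in this
direction. -/
theorem add_smul_mem_of_hessian_eq_zero (hf : IsSelfConcordant D f) {x h : E} (hx : x ∈ D)
    (h0 : fderiv ℝ (fderiv ℝ f) x h h = 0) (t : ℝ) : x + t • h ∈ D := by
  have hcont : Continuous fun t : ℝ => x + t • h := by fun_prop
  -- As `f` is affine in this direction, the admissible parameters are the preimage of the closed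
  -- epigraph under an affine map. They are open as well, hence all of ℝ.
  have key : {t : ℝ | x + t • h ∈ D} = (fun t : ℝ => (x + t • h, f x + t * fderiv ℝ f x h)) ⁻¹'
      {p : E × ℝ | p.1 ∈ D ∧ f p.1 ≤ p.2} := by
    ext t
    refine ⟨fun ht => ⟨ht, ?_⟩, fun ht => ht.1⟩
    have := hf.eq_add_fderiv_of_hessian_eq_zero (h := t • h) hx ht (by simp [h0])
    simp [this]
  have hclopen : IsClopen {t : ℝ | x + t • h ∈ D} :=
    ⟨key ▸ hf.isClosed_epigraph.preimage (by fun_prop), hf.isOpen_dom.preimage hcont⟩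
  have huniv := hclopen.eq_univ ⟨0, by simpa using hx⟩
  exact huniv.ge (mem_univ t)

/-- A self-concordant function which is nonincreasing and nondegenerate along a ray is unbounded
below on this ray. -/
theorem exists_lt_on_ray (hf : IsSelfConcordant D f) {x h : E}
    (hray : ∀ t : ℝ, 0 ≤ t → x + t • h ∈ D)
    (hneg : ∀ t : ℝ, 0 ≤ t → fderiv ℝ f (x + t • h) h ≤ 0)
    (hpos : ∀ t : ℝ, 0 ≤ t → 0 < fderiv ℝ (fderiv ℝ f) (x + t • h) h h) (M : ℝ) :
    ∃ t : ℝ, 0 ≤ t ∧ f (x + t • h) < M := by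
  set g : ℝ → ℝ := fun t => fderiv ℝ (fderiv ℝ f) (x + t • h) h h with hg
  set a : ℝ := (√(g 0))⁻¹ with ha
  have hapos : 0 < a := inv_pos.2 (Real.sqrt_pos.2 (hpos 0 le_rfl))
  have hgd : ∀ t : ℝ, 0 ≤ t → HasDerivAt g
      (fderiv ℝ (fderiv ℝ (fderiv ℝ f)) (x + t • h) h h h) t := fun t ht =>
    hasDerivAt_hessian_line (hf.contDiffAt (hray t ht))
  -- Self-concordance says that g^(-1/2) has derivative at most 1.
  have hq : ∀ t : ℝ, 0 ≤ t → (√(g t))⁻¹ ≤ a + t := by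
    have hmono : AntitoneOn (fun t => (√(g t))⁻¹ - t) (Ici 0) := by
      have hd : ∀ t : ℝ, 0 ≤ t → HasDerivAt (fun t => (√(g t))⁻¹ - t)
          (-(fderiv ℝ (fderiv ℝ (fderiv ℝ f)) (x + t • h) h h h / (2 * √(g t))) /
            (√(g t)) ^ 2 - 1) t := fun t ht =>
        (((hgd t ht).sqrt (hpos t ht).ne').inv (Real.sqrt_pos.2 (hpos t ht)).ne').sub
          (hasDerivAt_id t)
      refine antitoneOn_of_hasDerivWithinAt_nonpos (convex_Ici 0)
        (fun t ht => (hd t ht).continuousAt.continuousWithinAt)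
        (fun t ht => (hd t (interior_subset ht)).hasDerivWithinAt) fun t ht => ?_
      have ht' : 0 ≤ t := interior_subset ht
      have hgt : 0 < g t := hpos t ht'
      have h3 := (abs_le.1 (hf.abs_third_le (hray t ht') h)).1
      rw [show (3 / 2 : ℝ) = 1 / 2 + 1 by norm_num, Real.rpow_add' hgt.le (by norm_num),
        Real.rpow_one, ← Real.sqrt_eq_rpow] at h3
      change -(2 * (√(g t) * g t)) ≤ _ at h3
      have hs : 0 < √(g t) := Real.sqrt_pos.2 hgt
      rw [sub_nonpos, Real.sq_sqrt hgt.le, div_le_one hgt, ← neg_div, div_le_iff₀ (by positivity)]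
      linarith
    intro t ht
    have := hmono (mem_Ici.2 le_rfl) (mem_Ici.2 ht) ht
    simp only [sub_zero] at this
    linarith
  have hgl : ∀ t : ℝ, 0 ≤ t → ((a + t) ^ 2)⁻¹ ≤ g t := fun t ht => by
    have hs : 0 < √(g t) := Real.sqrt_pos.2 (hpos t ht)
    have h1 := pow_le_pow_left₀ (inv_nonneg.2 hs.le) (hq t ht) 2
    rw [inv_pow, Real.sq_sqrt (hpos t ht).le] at h1
    exact inv_le_of_inv_le₀ (hpos t ht) h1
  -- This integrates g ≥ (a + t)⁻² from t to infinity, where the slope is still nonpositive; a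
  -- second integration gives logarithmic decrease.
  have hslope : ∀ t : ℝ, 0 ≤ t → fderiv ℝ f (x + t • h) h ≤ -(a + t)⁻¹ := by
    have hmono : MonotoneOn (fun t : ℝ => fderiv ℝ f (x + t • h) h + (a + t)⁻¹) (Ici 0) := by
      have hd : ∀ t : ℝ, 0 ≤ t → HasDerivAt (fun t : ℝ => fderiv ℝ f (x + t • h) h + (a + t)⁻¹)
          (g t + -1 / (a + t) ^ 2) t := fun t ht =>
        (hasDerivAt_fderiv_line (hf.contDiffAt_two (hray t ht)) h).add
          (((hasDerivAt_id t).const_add a).inv (by simp; positivity))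
      refine monotoneOn_of_hasDerivWithinAt_nonneg (convex_Ici 0)
        (fun t ht => (hd t ht).continuousAt.continuousWithinAt)
        (fun t ht => (hd t (interior_subset ht)).hasDerivWithinAt) fun t ht => ?_
      have := hgl t (interior_subset ht)
      rw [neg_div, one_div]
      linarith
    intro t ht
    have hlim : Tendsto (fun s : ℝ => (a + s)⁻¹) atTop (𝓝 0) :=
      tendsto_inv_atTop_zero.comp (tendsto_atTop_add_const_left _ a tendsto_id)
    have : fderiv ℝ f (x + t • h) h + (a + t)⁻¹ ≤ 0 := by
      refine ge_of_tendsto hlim ?_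
      filter_upwards [eventually_ge_atTop t] with s hs
      have h1 := hmono (mem_Ici.2 ht) (mem_Ici.2 (ht.trans hs)) hs
      have h2 := hneg s (ht.trans hs)
      simp only at h1
      linarith
    linarith
  have hlog : AntitoneOn (fun t : ℝ => f (x + t • h) + Real.log (a + t)) (Ici 0) := by
    have hd : ∀ t : ℝ, 0 ≤ t → HasDerivAt (fun t : ℝ => f (x + t • h) + Real.log (a + t))
        (fderiv ℝ f (x + t • h) h + 1 / (a + t)) t := fun t ht =>
      (hasDerivAt_comp_line (hf.differentiableAt (hray t ht))).add
        (((hasDerivAt_id t).const_add a).log (by simp; positivity))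
    refine antitoneOn_of_hasDerivWithinAt_nonpos (convex_Ici 0)
      (fun t ht => (hd t ht).continuousAt.continuousWithinAt)
      (fun t ht => (hd t (interior_subset ht)).hasDerivWithinAt) fun t ht => ?_
    have := hslope t (interior_subset ht)
    rw [one_div]
    linarith
  have hlim : Tendsto (fun t : ℝ => Real.log (a + t)) atTop atTop :=
    Real.tendsto_log_atTop.comp (tendsto_atTop_add_const_left _ a tendsto_id)
  obtain ⟨t, ht0, ht⟩ := ((eventually_ge_atTop (0 : ℝ)).and
    (hlim.eventually_gt_atTop (f x + Real.log a - M))).exists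
  refine ⟨t, ht0, ?_⟩
  have := hlog (mem_Ici.2 le_rfl) (mem_Ici.2 ht0) ht0
  simp only [zero_smul, add_zero] at this
  linarith

end IsSelfConcordant

end Lines

/-! ### Interiors of a closed convex cone and of its dual. -/

section Cones

open Set Filter Topology

variable {E : Type*} [NormedAddCommGroup E] [NormedSpace ℝ E] {K : ProperCone ℝ E}

theorem add_mem_interior_cone {x y : E} (hx : x ∈ K) (hy : y ∈ interior (K : Set E)) :
    x + y ∈ interior (K : Set E) := by
  refine interior_maximal ?_ ((Homeomorph.addLeft x).isOpenMap _ isOpen_interior)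
    (mem_image_of_mem _ hy)
  rintro _ ⟨z, hz, rfl⟩
  exact add_mem hx (interior_subset hz)

theorem smul_mem_interior_cone {t : ℝ} (ht : 0 < t) {y : E} (hy : y ∈ interior (K : Set E)) :
    t • y ∈ interior (K : Set E) := by
  refine interior_maximal ?_ ((Homeomorph.smulOfNeZero t ht.ne').isOpenMap _ isOpen_interior)
    (mem_image_of_mem _ hy)
  rintro _ ⟨z, hz, rfl⟩
  exact ProperCone.smul_mem K (interior_subset hz) ht.le

/-- A direction of a ray contained in a closed convex cone belongs to this cone. -/
theorem mem_cone_of_ray {x h : E} (hray : ∀ t : ℝ, 0 < t → x + t • h ∈ K) : h ∈ K := by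
  have hlim : Tendsto (fun r : ℝ => r • x + h) (𝓝[>] 0) (𝓝 h) := by
    have : Continuous fun r : ℝ => r • x + h := by fun_prop
    simpa using (this.tendsto 0).mono_left nhdsWithin_le_nhds
  refine (ProperCone.isClosed K).mem_of_tendsto hlim ?_
  filter_upwards [self_mem_nhdsWithin] with r hr
  have hr' : 0 < r := hr
  have := ProperCone.smul_mem K (hray r⁻¹ (inv_pos.2 hr')) hr'.le
  rwa [smul_add, smul_inv_smul₀ hr'.ne'] at this

variable [FiniteDimensional ℝ E]

/-- Subtracting a small multiple of a functional norming x keeps s in the dual cone. -/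
theorem exists_mul_norm_le_of_mem_interior_dualCone {s : StrongDual ℝ E}
    (hs : s ∈ interior (dualCone K : Set (StrongDual ℝ E))) :
    ∃ δ > 0, ∀ x ∈ K, δ * ‖x‖ ≤ s x := by
  obtain ⟨δ, hδ, hball⟩ := Metric.mem_nhds_iff.1 (mem_interior_iff_mem_nhds.1 hs)
  refine ⟨δ / 2, by positivity, fun x hx => ?_⟩
  obtain ⟨g, hg, hgx⟩ := exists_dual_vector'' ℝ x
  have hmem : s - (δ / 2) • g ∈ (dualCone K : Set (StrongDual ℝ E)) := by
    refine hball ?_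
    rw [Metric.mem_ball, dist_eq_norm, sub_sub_cancel_left, norm_neg, norm_smul,
      Real.norm_of_nonneg (by positivity)]
    nlinarith
  have := mem_dualCone.1 hmem x hx
  rw [sub_apply, smul_apply, hgx] at this
  simpa using this

theorem pos_of_mem_interior_dualCone {s : StrongDual ℝ E}
    (hs : s ∈ interior (dualCone K : Set (StrongDual ℝ E))) {x : E} (hx : x ∈ K) (hx0 : x ≠ 0) :
    0 < s x := by
  obtain ⟨δ, hδ, h⟩ := exists_mul_norm_le_of_mem_interior_dualCone hs
  exact lt_of_lt_of_le (mul_pos hδ (norm_pos_iff.2 hx0)) (h x hx)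

/-- A functional that is zero at x would have a local minimum there, and a linear functional with a
local minimum is zero. -/
theorem pos_of_mem_dualCone_of_mem_interior {q : StrongDual ℝ E} (hq : q ∈ dualCone K)
    (hq0 : q ≠ 0) {x : E} (hx : x ∈ interior (K : Set E)) : 0 < q x := by
  refine lt_of_le_of_ne (mem_dualCone.1 hq x (interior_subset hx)) fun h0 => hq0 ?_
  have hmin : IsLocalMin q x := by
    filter_upwards [mem_interior_iff_mem_nhds.1 hx] with y hy
    rw [← h0]
    exact mem_dualCone.1 hq y hy
  exact hmin.hasFDerivAt_eq_zero q.hasFDerivAt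

/-- By compactness s is bounded below by some m > 0 on the unit vectors of K, and the ball of radius
m around s stays in the dual cone. -/
theorem mem_interior_dualCone_of_pos {s : StrongDual ℝ E} (hs : ∀ x ∈ K, x ≠ 0 → 0 < s x) :
    s ∈ interior (dualCone K : Set (StrongDual ℝ E)) := by
  have hcomp : IsCompact ((K : Set E) ∩ Metric.sphere 0 1) :=
    (isCompact_sphere 0 1).inter_left (ProperCone.isClosed K)
  have hne : ∀ x : E, x ∈ Metric.sphere (0 : E) 1 → x ≠ 0 := by
    rintro x hx rfl
    simp at hx
  obtain ⟨m, hm, hmin⟩ : ∃ m > 0, ∀ x ∈ (K : Set E) ∩ Metric.sphere 0 1, m ≤ s x := by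
    rcases ((K : Set E) ∩ Metric.sphere 0 1).eq_empty_or_nonempty with he | hnon
    · exact ⟨1, one_pos, by simp [he]⟩
    · obtain ⟨x, hx, hmin⟩ := hcomp.exists_isMinOn hnon s.continuous.continuousOn
      exact ⟨s x, hs x hx.1 (hne x hx.2), fun y hy => hmin hy⟩
  refine mem_interior_iff_mem_nhds.2 (Metric.mem_nhds_iff.2 ⟨m, hm, fun g hg => ?_⟩)
  refine mem_dualCone.2 fun x hx => ?_
  rcases eq_or_ne x 0 with rfl | hx0
  · simp
  have hnx := norm_pos_iff.2 hx0
  have h1 := hmin (‖x‖⁻¹ • x) ⟨ProperCone.smul_mem K hx (by positivity), by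
    simp [norm_smul, hnx.ne']⟩
  rw [map_smul, smul_eq_mul, ← div_eq_inv_mul, le_div_iff₀ hnx] at h1
  have h2 := (le_abs_self _).trans ((s - g).le_opNorm x)
  rw [Metric.mem_ball, dist_comm, dist_eq_norm] at hg
  rw [sub_apply] at h2
  nlinarith

end Cones

/-! ### Logarithmically homogeneous barriers: identities, signs of the gradient, and attainment of
the conjugate. -/

namespace IsRegularBarrier

open Set Filter Topology

variable {E : Type*} [NormedAddCommGroup E] [NormedSpace ℝ E] {K : ProperCone ℝ E}
  {F : E → ℝ} {ν : ℝ}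

theorem selfConcordant (hF : IsRegularBarrier K F ν) :
    IsSelfConcordant (interior (K : Set E)) F := hF.barrier.selfConcordant

/-- A degenerate direction would give a full line inside the interior of K, which a pointed cone
excludes. -/
theorem hessian_pos (hF : IsRegularBarrier K F ν) (hK : ∀ x ∈ K, -x ∈ K → x = 0) {x h : E}
    (hx : x ∈ interior (K : Set E)) (hh : h ≠ 0) : 0 < fderiv ℝ (fderiv ℝ F) x h h := by
  refine lt_of_le_of_ne (hF.selfConcordant.hessian_nonneg hx h) fun h0 => hh ?_
  have hline := hF.selfConcordant.add_smul_mem_of_hessian_eq_zero hx h0.symm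
  refine hK h (mem_cone_of_ray (x := x) fun t _ => interior_subset (hline t))
    (mem_cone_of_ray (x := x) fun t _ => ?_)
  rw [smul_neg, ← neg_smul]
  exact interior_subset (hline (-t))

theorem fderiv_self (hF : IsRegularBarrier K F ν) {x : E} (hx : x ∈ interior (K : Set E)) :
    fderiv ℝ F x x = -ν := by
  have h1 : HasDerivAt (fun t : ℝ => F (t • x)) (fderiv ℝ F x x) 1 := by
    have h0 : HasFDerivAt F (fderiv ℝ F x) ((1 : ℝ) • x) := by
      simpa using (hF.selfConcordant.differentiableAt hx).hasFDerivAt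
    exact (h0.comp_hasDerivAt (1 : ℝ) ((hasDerivAt_id (1 : ℝ)).smul_const x)).congr_deriv
      (by simp)
  have h2 : HasDerivAt (fun t : ℝ => F x - ν * Real.log t) (-ν) 1 :=
    (((Real.hasDerivAt_log one_ne_zero).const_mul ν).const_sub (F x)).congr_deriv (by simp)
  refine h1.unique (h2.congr_of_eventuallyEq ?_)
  filter_upwards [lt_mem_nhds (zero_lt_one (α := ℝ))] with t ht
  exact hF.log_homogeneous x hx t ht

theorem ne_zero_of_mem_interior (hF : IsRegularBarrier K F ν) {x : E}
    (hx : x ∈ interior (K : Set E)) : x ≠ 0 := by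
  rintro rfl
  have h1 := hF.fderiv_self hx
  have h2 := hF.barrier.one_le_param
  rw [map_zero] at h1
  linarith

/-- Differentiate the Euler identity ∇F(y) y = -ν in y. This identity transfers the parameter ν to
the dual barrier. -/
theorem hessian_self (hF : IsRegularBarrier K F ν) {x : E} (hx : x ∈ interior (K : Set E))
    (h : E) : fderiv ℝ (fderiv ℝ F) x x h = -fderiv ℝ F x h := by
  have h1 : HasFDerivAt (fun y : E => fderiv ℝ F y y)
      ((fderiv ℝ F x).comp (ContinuousLinearMap.id ℝ E) +
        (fderiv ℝ (fderiv ℝ F) x).flip x) x :=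
    (differentiableAt_fderiv (hF.selfConcordant.contDiffAt_two hx)).hasFDerivAt.clm_apply
      (hasFDerivAt_id x)
  have h2 : HasFDerivAt (fun y : E => fderiv ℝ F y y) (0 : E →L[ℝ] ℝ) x := by
    refine (hasFDerivAt_const (-ν) x).congr_of_eventuallyEq ?_
    filter_upwards [isOpen_interior.mem_nhds hx] with y hy
    exact hF.fderiv_self hy
  have h3 := DFunLike.congr_fun (h1.unique h2) h
  simp only [add_apply, ContinuousLinearMap.comp_id, ContinuousLinearMap.flip_apply,
    zero_apply] at h3
  rw [fderiv_fderiv_symm (hF.selfConcordant.contDiffAt_two hx)]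
  linarith

/-- A logarithmically homogeneous barrier has slower than linear decay at infinity. -/
theorem exists_sub_mul_norm_le (hF : IsRegularBarrier K F ν)
    (hne : (interior (K : Set E)).Nonempty) {δ : ℝ} (hδ : 0 < δ) :
    ∃ C : ℝ, ∀ y ∈ interior (K : Set E), C - δ * ‖y‖ ≤ F y := by
  obtain ⟨z, hz⟩ := hne
  -- Rescaling y by r costs only the constant ν log r, while the affine minorant at z then has slope
  -- at most δ.
  set r : ℝ := δ / (‖fderiv ℝ F z‖ + 1)
  have hr : 0 < r := by positivity
  refine ⟨F z - fderiv ℝ F z z + ν * Real.log r, fun y hy => ?_⟩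
  have h1 := add_fderiv_le_of_convexOn hF.selfConcordant.convexOn hz
    (smul_mem_interior_cone hr hy) (hF.selfConcordant.differentiableAt hz)
  rw [hF.log_homogeneous y hy r hr, map_sub, map_smul, smul_eq_mul] at h1
  have h2 := (neg_le_abs _).trans ((fderiv ℝ F z).le_opNorm y)
  have h3 : r * (‖fderiv ℝ F z‖ * ‖y‖) ≤ δ * ‖y‖ := by
    rw [← mul_assoc]
    gcongr
    rw [div_mul_eq_mul_div, div_le_iff₀ (by positivity)]
    nlinarith
  have h4 := mul_le_mul_of_nonneg_left h2 hr.le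
  linarith

/-- The gradient inequality between z and t w, divided by t, leaves only logarithmic growth on the
right as t → ∞. Boundary points y are approached by y + r z. -/
theorem fderiv_nonpos (hF : IsRegularBarrier K F ν) {z y : E} (hz : z ∈ interior (K : Set E))
    (hy : y ∈ K) : fderiv ℝ F z y ≤ 0 := by
  have hint : ∀ w ∈ interior (K : Set E), fderiv ℝ F z w ≤ 0 := by
    intro w hw
    have hlim : Tendsto (fun t : ℝ => (F w - F z - ν) * t⁻¹ - ν * (Real.log t * t⁻¹)) atTop
        (𝓝 ((F w - F z - ν) * 0 - ν * 0)) := by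
      refine (tendsto_inv_atTop_zero.const_mul _).sub (Tendsto.const_mul ν ?_)
      simpa [div_eq_mul_inv] using Real.tendsto_pow_log_div_mul_add_atTop 1 0 1 one_ne_zero
    rw [mul_zero, mul_zero, sub_zero] at hlim
    refine ge_of_tendsto hlim ?_
    filter_upwards [eventually_gt_atTop (0 : ℝ)] with t ht
    have h1 := add_fderiv_le_of_convexOn hF.selfConcordant.convexOn hz
      (smul_mem_interior_cone ht hw) (hF.selfConcordant.differentiableAt hz)
    rw [hF.log_homogeneous w hw t ht, map_sub, map_smul, smul_eq_mul, hF.fderiv_self hz] at h1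
    have : fderiv ℝ F z w = (t * fderiv ℝ F z w) * t⁻¹ := by field_simp
    rw [this]
    calc (t * fderiv ℝ F z w) * t⁻¹ ≤ (F w - F z - ν - ν * Real.log t) * t⁻¹ := by
          gcongr; linarith
      _ = _ := by ring
  have hlim : Tendsto (fun r : ℝ => fderiv ℝ F z (y + r • z)) (𝓝[>] 0) (𝓝 (fderiv ℝ F z y)) := by
    have : Continuous fun r : ℝ => fderiv ℝ F z (y + r • z) := by fun_prop
    simpa using (this.tendsto 0).mono_left nhdsWithin_le_nhds
  refine le_of_tendsto hlim ?_
  filter_upwards [self_mem_nhdsWithin] with r hr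
  exact hint _ (add_mem_interior_cone hy (smul_mem_interior_cone hr hz))

/-- The slope along z + t y strictly increases and is still nonpositive at t = 1. -/
theorem fderiv_neg (hF : IsRegularBarrier K F ν) (hK : ∀ x ∈ K, -x ∈ K → x = 0) {z y : E}
    (hz : z ∈ interior (K : Set E)) (hy : y ∈ K) (hy0 : y ≠ 0) : fderiv ℝ F z y < 0 := by
  have hmem : ∀ t : ℝ, 0 ≤ t → z + t • y ∈ interior (K : Set E) := fun t ht => by
    rw [add_comm]; exact add_mem_interior_cone (ProperCone.smul_mem K hy ht) hz
  have hd : ∀ t : ℝ, 0 ≤ t → HasDerivAt (fun t : ℝ => fderiv ℝ F (z + t • y) y)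
      (fderiv ℝ (fderiv ℝ F) (z + t • y) y y) t := fun t ht =>
    hasDerivAt_fderiv_line (hF.selfConcordant.contDiffAt_two (hmem t ht)) y
  have hmono : StrictMonoOn (fun t : ℝ => fderiv ℝ F (z + t • y) y) (Icc 0 1) := by
    refine strictMonoOn_of_deriv_pos (convex_Icc 0 1)
      (fun t ht => (hd t ht.1).continuousAt.continuousWithinAt) fun t ht => ?_
    have ht' := interior_subset ht
    rw [(hd t ht'.1).deriv]
    exact hF.hessian_pos hK (hmem t ht'.1) hy0
  have h1 := hmono (left_mem_Icc.2 zero_le_one) (right_mem_Icc.2 zero_le_one) zero_lt_one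
  have h2 := hF.fderiv_nonpos (hmem 1 zero_le_one) hy
  simp only [zero_smul, add_zero] at h1
  linarith

theorem isGreatest_conj (hF : IsRegularBarrier K F ν) {s : StrongDual ℝ E} {x : E}
    (hx : x ∈ interior (K : Set E)) (hxs : fderiv ℝ F x = -s) :
    IsGreatest ((fun x : E => -s x - F x) '' interior (K : Set E)) (-s x - F x) := by
  refine ⟨mem_image_of_mem _ hx, ?_⟩
  rintro _ ⟨y, hy, rfl⟩
  have := add_fderiv_le_of_convexOn hF.selfConcordant.convexOn hx hy
    (hF.selfConcordant.differentiableAt hx)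
  rw [hxs] at this
  simp only [neg_apply, map_sub] at this ⊢
  linarith

theorem dualBarrier_eq (hF : IsRegularBarrier K F ν) {s : StrongDual ℝ E} {x : E}
    (hx : x ∈ interior (K : Set E)) (hxs : fderiv ℝ F x = -s) :
    dualBarrier K F s = -s x - F x :=
  (hF.isGreatest_conj hx hxs).csSup_eq

variable [FiniteDimensional ℝ E]

theorem neg_fderiv_mem_interior_dualCone (hF : IsRegularBarrier K F ν)
    (hK : ∀ x ∈ K, -x ∈ K → x = 0) {x : E} (hx : x ∈ interior (K : Set E)) :
    -fderiv ℝ F x ∈ interior (dualCone K : Set (StrongDual ℝ E)) :=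
  mem_interior_dualCone_of_pos fun y hy hy0 => by
    simpa using hF.fderiv_neg hK hx hy hy0

/-- The point x minimizes s + F: linear growth of s on K dominates the decay of F, and the closed
epigraph keeps minimizing points off the boundary. -/
theorem exists_fderiv_eq_neg (hF : IsRegularBarrier K F ν)
    (hne : (interior (K : Set E)).Nonempty) {s : StrongDual ℝ E}
    (hs : s ∈ interior (dualCone K : Set (StrongDual ℝ E))) :
    ∃ x ∈ interior (K : Set E), fderiv ℝ F x = -s := by
  obtain ⟨δ, hδ, hsδ⟩ := exists_mul_norm_le_of_mem_interior_dualCone hs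
  obtain ⟨C, hC⟩ := hF.exists_sub_mul_norm_le hne (half_pos hδ)
  obtain ⟨z, hz⟩ := hne
  set S : Set E := {y | y ∈ interior (K : Set E) ∧ F y ≤ s z + F z - s y} with hS
  have hclosed : IsClosed S :=
    hF.selfConcordant.isClosed_epigraph.preimage
      (f := fun y : E => (y, s z + F z - s y)) (by fun_prop)
  have hbdd : S ⊆ Metric.closedBall 0 ((s z + F z - C) / (δ / 2)) := by
    rintro y ⟨hy, hyM⟩
    have h1 := hC y hy
    have h2 := hsδ y (interior_subset hy)
    rw [mem_closedBall_zero_iff, le_div_iff₀ (by positivity)]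
    linarith
  have hcomp : IsCompact S := (isCompact_closedBall _ _).of_isClosed_subset hclosed hbdd
  have hFc : ContinuousOn (fun y => s y + F y) S := fun y hy =>
    (s.continuous.continuousAt.add
      (hF.selfConcordant.differentiableAt hy.1).continuousAt).continuousWithinAt
  obtain ⟨x, hx, hmin⟩ := hcomp.exists_isMinOn ⟨z, hz, by simp⟩ hFc
  have hloc : IsLocalMin (fun y => s y + F y) x := by
    filter_upwards [isOpen_interior.mem_nhds hx.1] with y hy
    by_cases hyS : y ∈ S
    · exact hmin hyS
    · have h1 : ¬ F y ≤ s z + F z - s y := fun h => hyS ⟨hy, h⟩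
      have h2 := hx.2
      push Not at h1
      linarith
  have h0 := hloc.hasFDerivAt_eq_zero
    (s.hasFDerivAt.add (hF.selfConcordant.differentiableAt hx.1).hasFDerivAt)
  exact ⟨x, hx.1, eq_neg_of_add_eq_zero_right h0⟩

theorem le_dualBarrier (hF : IsRegularBarrier K F ν) {s : StrongDual ℝ E}
    (hs : s ∈ interior (dualCone K : Set (StrongDual ℝ E))) {y : E}
    (hy : y ∈ interior (K : Set E)) : -s y - F y ≤ dualBarrier K F s := by
  obtain ⟨x, hx, hxs⟩ := hF.exists_fderiv_eq_neg ⟨y, hy⟩ hs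
  rw [hF.dualBarrier_eq hx hxs]
  exact (hF.isGreatest_conj hx hxs).2 (mem_image_of_mem _ hy)

end IsRegularBarrier

/-! ### Higher derivatives of a conjugate function. -/

section Conjugation

open Filter Topology

variable {E V : Type*} [NormedAddCommGroup E] [NormedSpace ℝ E] [NormedAddCommGroup V]
  [NormedSpace ℝ V] {F : E → ℝ} {f : V → ℝ} {B : E →L[ℝ] V →L[ℝ] ℝ} {ψ : V → E} {s : V}

theorem contDiffAt_conj
    (hψ : ∀ᶠ t in 𝓝 s, ContDiffAt ℝ 2 ψ t ∧ ContDiffAt ℝ 3 F (ψ t) ∧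
      fderiv ℝ F (ψ t) = -B.flip t ∧ HasFDerivAt f (-B (ψ t)) t) :
    ContDiffAt ℝ 3 f s :=
  (contDiffAt_succ_iff_hasFDerivAt (n := 2)).2
    ⟨fun s => -B (ψ s), ⟨_, hψ, fun _ ht => ht.2.2.2⟩,
      (B.contDiff.contDiffAt.comp s hψ.self_of_nhds.1).neg⟩

/-- The second and third differentials of a function whose gradient map is, up to signs, a local
inverse of the gradient map of another function. -/
theorem conj_derivatives
    (hψ : ∀ᶠ t in 𝓝 s, ContDiffAt ℝ 2 ψ t ∧ ContDiffAt ℝ 3 F (ψ t) ∧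
      fderiv ℝ F (ψ t) = -B.flip t ∧ HasFDerivAt f (-B (ψ t)) t) (h : V) :
    fderiv ℝ (fderiv ℝ F) (ψ s) (fderiv ℝ ψ s h) = -B.flip h ∧
      iteratedFDeriv ℝ 2 f s (fun _ => h) =
        fderiv ℝ (fderiv ℝ F) (ψ s) (fderiv ℝ ψ s h) (fderiv ℝ ψ s h) ∧
      iteratedFDeriv ℝ 3 f s (fun _ => h) =
        -fderiv ℝ (fderiv ℝ (fderiv ℝ F)) (ψ s) (fderiv ℝ ψ s h) (fderiv ℝ ψ s h)
          (fderiv ℝ ψ s h) := by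
  have hcd : ContDiffAt ℝ 3 f s := contDiffAt_conj hψ
  obtain ⟨hψc, hψF, -, -⟩ := hψ.self_of_nhds
  have hderiv : ∀ᶠ t in 𝓝 s, fderiv ℝ (fderiv ℝ F) (ψ t) (fderiv ℝ ψ t h) = -B.flip h ∧
      fderiv ℝ (fderiv ℝ f) t h h = -B (fderiv ℝ ψ t h) h := by
    filter_upwards [hψ, hψ.eventually_nhds] with t ⟨k1, k2, k3, k4⟩ hev
    have hd := (k1.differentiableAt (by norm_num)).hasFDerivAt
    constructor
    · have e1 := (differentiableAt_fderiv (k2.of_le (by norm_num))).hasFDerivAt.comp t hd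
      have e2 : HasFDerivAt (fderiv ℝ F ∘ ψ) (-B.flip) t :=
        B.flip.hasFDerivAt.neg.congr_of_eventuallyEq (hev.mono fun r hr => hr.2.2.1)
      simpa using DFunLike.congr_fun (e1.unique e2) h
    · have e1 : HasFDerivAt (fun r => -B (ψ r)) (-B.comp (fderiv ℝ ψ t)) t :=
        (B.hasFDerivAt.comp t hd).neg
      have e2 : fderiv ℝ f =ᶠ[𝓝 t] fun r => -B (ψ r) := hev.mono fun r hr => hr.2.2.2.fderiv
      rw [e2.fderiv_eq, e1.fderiv]
      simp
  obtain ⟨hHw, hH⟩ := hderiv.self_of_nhds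
  rw [iteratedFDeriv_two_diag, iteratedFDeriv_three_diag]
  refine ⟨hHw, by rw [hH, hHw]; simp, ?_⟩
  have hline : Tendsto (fun t : ℝ => s + t • h) (𝓝 0) (𝓝 s) := by
    have : Continuous fun t : ℝ => s + t • h := by fun_prop
    simpa using this.tendsto 0
  have hs0 : s + (0 : ℝ) • h = s := by simp
  have hw' : HasDerivAt (fun t : ℝ => fderiv ℝ ψ (s + t • h) h)
      (fderiv ℝ (fderiv ℝ ψ) s h h) 0 := by
    have h0 : HasDerivAt (fun t : ℝ => fderiv ℝ ψ (s + t • h)) (fderiv ℝ (fderiv ℝ ψ) s h) 0 := by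
      have := hasDerivAt_comp_line (f := fderiv ℝ ψ) (x := s) (h := h) (t := 0)
        (by rw [hs0]; exact differentiableAt_fderiv hψc)
      rwa [hs0] at this
    exact hasDerivAt_clm_apply h0 h
  have hthird : fderiv ℝ (fderiv ℝ (fderiv ℝ f)) s h h h =
      -B (fderiv ℝ (fderiv ℝ ψ) s h h) h := by
    have k1 := hasDerivAt_hessian_line (f := f) (x := s) (h := h) (t := 0) (by rwa [hs0])
    rw [hs0] at k1
    have k2 : HasDerivAt (fun t : ℝ => -B.flip h (fderiv ℝ ψ (s + t • h) h))
        (-B.flip h (fderiv ℝ (fderiv ℝ ψ) s h h)) 0 :=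
      ((B.flip h).hasFDerivAt.comp_hasDerivAt 0 hw').neg
    exact k1.unique (k2.congr_of_eventuallyEq
      ((hline.eventually hderiv).mono fun t ht => ht.2))
  -- Differentiate ∇²F(ψ) ψ'h = -h along h. Pairing with ψ'h and using symmetry of ∇²F then
  -- eliminates the second derivative of ψ.
  have hprod : fderiv ℝ (fderiv ℝ (fderiv ℝ F)) (ψ s) (fderiv ℝ ψ s h) (fderiv ℝ ψ s h) +
      fderiv ℝ (fderiv ℝ F) (ψ s) (fderiv ℝ (fderiv ℝ ψ) s h h) = 0 := by
    have k0 : HasDerivAt (fun t : ℝ => ψ (s + t • h)) (fderiv ℝ ψ s h) 0 := by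
      have := hasDerivAt_comp_line (f := ψ) (x := s) (h := h) (t := 0)
        (by rw [hs0]; exact hψc.differentiableAt (by norm_num))
      rwa [hs0] at this
    have k1 : HasDerivAt (fun t : ℝ => fderiv ℝ (fderiv ℝ F) (ψ (s + t • h)))
        (fderiv ℝ (fderiv ℝ (fderiv ℝ F)) (ψ s) (fderiv ℝ ψ s h)) 0 := by
      have : HasFDerivAt (fderiv ℝ (fderiv ℝ F)) (fderiv ℝ (fderiv ℝ (fderiv ℝ F)) (ψ s))
          (ψ (s + (0 : ℝ) • h)) := by
        rw [hs0]
        exact (differentiableAt_fderiv_fderiv hψF).hasFDerivAt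
      exact HasFDerivAt.comp_hasDerivAt (l := fderiv ℝ (fderiv ℝ F)) 0 this k0
    have k2 := k1.clm_apply hw'
    rw [hs0] at k2
    exact k2.unique ((hasDerivAt_const (0 : ℝ) (-B.flip h)).congr_of_eventuallyEq
      ((hline.eventually hderiv).mono fun t ht => ht.1))
  have k1 := DFunLike.congr_fun hprod (fderiv ℝ ψ s h)
  rw [add_apply, zero_apply, fderiv_fderiv_symm (hψF.of_le (by norm_num)), hHw, neg_apply,
    ContinuousLinearMap.flip_apply] at k1
  rw [hthird]
  linarith

end Conjugation

/-! ### The dual barrier. -/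

namespace IsRegularBarrier

open Set Filter Topology

variable {E : Type*} [NormedAddCommGroup E] [NormedSpace ℝ E] [FiniteDimensional ℝ E]
  {K : ProperCone ℝ E} {F : E → ℝ} {ν : ℝ}

/-- The gradient map of the barrier has a local inverse, which parametrizes the gradient of the
dual barrier. -/
theorem exists_local_inverse (hF : IsRegularBarrier K F ν) (hK : ∀ x ∈ K, -x ∈ K → x = 0)
    (hne : (interior (K : Set E)).Nonempty) {s₀ : StrongDual ℝ E}
    (hs₀ : s₀ ∈ interior (dualCone K : Set (StrongDual ℝ E))) :
    ∃ ψ : StrongDual ℝ E → E, ∀ᶠ s in 𝓝 s₀, ContDiffAt ℝ 2 ψ s ∧ ψ s ∈ interior (K : Set E) ∧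
      fderiv ℝ F (ψ s) = -s ∧
      HasFDerivAt (dualBarrier K F) (-ContinuousLinearMap.apply ℝ ℝ (ψ s)) s := by
  obtain ⟨x₀, hx₀, hxs⟩ := hF.exists_fderiv_eq_neg hne hs₀
  have hinj : Function.Injective (fderiv ℝ (fderiv ℝ F) x₀ : E →ₗ[ℝ] StrongDual ℝ E) := by
    rw [injective_iff_map_eq_zero]
    intro h hh
    by_contra h0
    have hpos := hF.hessian_pos hK hx₀ h0
    rw [ContinuousLinearMap.coe_coe] at hh
    simp [hh] at hpos
  have hrank : Module.finrank ℝ E = Module.finrank ℝ (StrongDual ℝ E) := by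
    rw [← (LinearMap.toContinuousLinearMap (𝕜 := ℝ) (E := E) (F' := ℝ)).finrank_eq]
    exact Subspace.dual_finrank_eq.symm
  let e : E ≃L[ℝ] StrongDual ℝ E :=
    (LinearMap.linearEquivOfInjective _ hinj hrank).toContinuousLinearEquiv
  have he : (e : E →L[ℝ] StrongDual ℝ E) = fderiv ℝ (fderiv ℝ F) x₀ := by
    ext1 x; rfl
  have hc : ContDiffAt ℝ 2 (fderiv ℝ F) x₀ := contDiffAt_fderiv (hF.selfConcordant.contDiffAt hx₀)
  have hd : HasFDerivAt (fderiv ℝ F) (e : E →L[ℝ] StrongDual ℝ E) x₀ :=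
    he ▸ (hc.differentiableAt (by norm_num)).hasFDerivAt
  have hst := hc.hasStrictFDerivAt' hd (by norm_num)
  have hneg : Tendsto (fun s : StrongDual ℝ E => -s) (𝓝 s₀) (𝓝 (fderiv ℝ F x₀)) := by
    rw [hxs]; exact continuous_neg.tendsto s₀
  have hψc : ContDiffAt ℝ 2 (fun s => hc.localInverse hd (by norm_num) (-s)) s₀ := by
    have := hc.to_localInverse hd (by norm_num)
    rw [hxs] at this
    exact this.comp s₀ contDiffAt_id.neg
  have hψx : hc.localInverse hd (by norm_num) (-s₀) = x₀ := by
    rw [← hxs]; exact hc.localInverse_apply_image hd (by norm_num)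
  refine ⟨fun s => hc.localInverse hd (by norm_num) (-s), ?_⟩
  set ψ : StrongDual ℝ E → E := fun s => hc.localInverse hd (by norm_num) (-s) with hψ
  have h1 : ∀ᶠ s in 𝓝 s₀, ContDiffAt ℝ 2 ψ s := hψc.eventually (by simp)
  have h2 : ∀ᶠ s in 𝓝 s₀, ψ s ∈ interior (K : Set E) :=
    hψc.continuousAt.eventually_mem (isOpen_interior.mem_nhds (by rw [hψ]; simpa [hψx] using hx₀))
  have h3 : ∀ᶠ s in 𝓝 s₀, fderiv ℝ F (ψ s) = -s := hneg.eventually hst.eventually_right_inverse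
  filter_upwards [h1, h2, h3, h2.eventually_nhds, h3.eventually_nhds] with s k1 k2 k3 k4 k5
  refine ⟨k1, k2, k3, ?_⟩
  have hψd := (k1.differentiableAt (by norm_num)).hasFDerivAt
  -- In the derivative of -s(ψ s) - F(ψ s) the terms containing ψ' cancel, because ∇F(ψ s) = -s.
  have hA := ((hasFDerivAt_id s).clm_apply hψd).neg.sub
    ((hF.selfConcordant.differentiableAt k2).hasFDerivAt.comp s hψd)
  refine (hA.congr_fderiv ?_).congr_of_eventuallyEq ?_
  · ext h
    simp [k3]
  · filter_upwards [k4, k5] with t ht1 ht2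
    exact hF.dualBarrier_eq ht1 ht2

/-- The derivatives of the dual barrier at `s`, in terms of those of the barrier at the point `x`
with `∇F(x) = -s`. -/
theorem exists_dual_derivatives (hF : IsRegularBarrier K F ν) (hK : ∀ x ∈ K, -x ∈ K → x = 0)
    (hne : (interior (K : Set E)).Nonempty) {s : StrongDual ℝ E}
    (hs : s ∈ interior (dualCone K : Set (StrongDual ℝ E))) :
    ContDiffAt ℝ 3 (dualBarrier K F) s ∧ ∃ x ∈ interior (K : Set E),
      fderiv ℝ (dualBarrier K F) s = -ContinuousLinearMap.apply ℝ ℝ x ∧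
      ∀ h : StrongDual ℝ E, ∃ w : E, fderiv ℝ (fderiv ℝ F) x w = -h ∧
        iteratedFDeriv ℝ 2 (dualBarrier K F) s (fun _ => h) = fderiv ℝ (fderiv ℝ F) x w w ∧
        iteratedFDeriv ℝ 3 (dualBarrier K F) s (fun _ => h) =
          -fderiv ℝ (fderiv ℝ (fderiv ℝ F)) x w w w := by
  obtain ⟨ψ, hψ⟩ := hF.exists_local_inverse hK hne hs
  have hflip : ∀ t : StrongDual ℝ E,
      (ContinuousLinearMap.apply ℝ ℝ : E →L[ℝ] StrongDual ℝ E →L[ℝ] ℝ).flip t = t := fun t => by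
    ext x; rfl
  have hψ' : ∀ᶠ t in 𝓝 s, ContDiffAt ℝ 2 ψ t ∧ ContDiffAt ℝ 3 F (ψ t) ∧
      fderiv ℝ F (ψ t) =
        -(ContinuousLinearMap.apply ℝ ℝ : E →L[ℝ] StrongDual ℝ E →L[ℝ] ℝ).flip t ∧
      HasFDerivAt (dualBarrier K F) (-ContinuousLinearMap.apply ℝ ℝ (ψ t)) t :=
    hψ.mono fun t ht => ⟨ht.1, hF.selfConcordant.contDiffAt ht.2.1, by rw [hflip, ht.2.2.1],
      ht.2.2.2⟩
  obtain ⟨-, hψs, -, hψd⟩ := hψ.self_of_nhds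
  refine ⟨contDiffAt_conj hψ', ψ s, hψs, hψd.fderiv, fun h => ⟨fderiv ℝ ψ s h, ?_⟩⟩
  have := conj_derivatives hψ' h
  rwa [hflip] at this

/-- The point attaining the supremum at the convex combination competes at both endpoints. -/
theorem convexOn_dualBarrier (hF : IsRegularBarrier K F ν)
    (hne : (interior (K : Set E)).Nonempty) :
    ConvexOn ℝ (interior (dualCone K : Set (StrongDual ℝ E))) (dualBarrier K F) := by
  have hconv : Convex ℝ (interior (dualCone K : Set (StrongDual ℝ E))) :=
    (ProperCone.convex _).interior
  refine ⟨hconv, fun s hs t ht a b ha hb hab => ?_⟩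
  obtain ⟨x, hx, hxs⟩ := hF.exists_fderiv_eq_neg hne (hconv hs ht ha hb hab)
  rw [hF.dualBarrier_eq hx hxs]
  have h1 := mul_le_mul_of_nonneg_left (hF.le_dualBarrier hs hx) ha
  have h2 := mul_le_mul_of_nonneg_left (hF.le_dualBarrier ht hx) hb
  have h3 : F x = a * F x + b * F x := by rw [← add_mul, hab, one_mul]
  simp only [add_apply, smul_apply, smul_eq_mul]
  linarith

/-- A limit s outside the interior would vanish at some nonzero x ∈ K. The bound -s y - F y ≤ M
survives in the limit, yet along z + t x the value of s is constant and F is unbounded below. -/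
theorem closure_sublevel_dualBarrier_subset (hF : IsRegularBarrier K F ν)
    (hK : ∀ x ∈ K, -x ∈ K → x = 0) (hne : (interior (K : Set E)).Nonempty) (M : ℝ) :
    closure {s | s ∈ interior (dualCone K : Set (StrongDual ℝ E)) ∧ dualBarrier K F s ≤ M} ⊆
      interior (dualCone K : Set (StrongDual ℝ E)) := by
  intro s hs
  have hdual : s ∈ dualCone K :=
    closure_minimal (fun t ht => interior_subset ht.1) (ProperCone.isClosed _) hs
  have hle : ∀ y ∈ interior (K : Set E), -s y - F y ≤ M := by
    intro y hy
    have hcl : IsClosed {t : StrongDual ℝ E | -t y - F y ≤ M} :=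
      isClosed_le (by fun_prop) continuous_const
    exact closure_minimal (fun t ht => (hF.le_dualBarrier ht.1 hy).trans ht.2) hcl hs
  refine mem_interior_dualCone_of_pos fun x hx hx0 => ?_
  refine lt_of_le_of_ne (mem_dualCone.1 hdual x hx) fun h0 => ?_
  obtain ⟨z, hz⟩ := hne
  have hray : ∀ t : ℝ, 0 ≤ t → z + t • x ∈ interior (K : Set E) := fun t ht => by
    rw [add_comm]; exact add_mem_interior_cone (ProperCone.smul_mem K hx ht) hz
  obtain ⟨t, ht, hlt⟩ := hF.selfConcordant.exists_lt_on_ray hray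
    (fun t ht => hF.fderiv_nonpos (hray t ht) hx)
    (fun t ht => hF.hessian_pos hK (hray t ht) hx0) (-M - s z)
  have := hle _ (hray t ht)
  rw [map_add, map_smul, ← h0, smul_zero] at this
  linarith

/-- The dual barrier is a self-concordant barrier for the dual cone with the same parameter. -/
theorem dualBarrier_barrier (hF : IsRegularBarrier K F ν) (hK : ∀ x ∈ K, -x ∈ K → x = 0)
    (hne : (interior (K : Set E)).Nonempty) :
    IsSelfConcordantBarrier (interior (dualCone K : Set (StrongDual ℝ E))) (dualBarrier K F) ν := by
  have hcd : ContDiffOn ℝ 3 (dualBarrier K F) (interior (dualCone K : Set (StrongDual ℝ E))) :=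
    fun s hs => (hF.exists_dual_derivatives hK hne hs).1.contDiffWithinAt
  refine ⟨⟨isOpen_interior, hF.convexOn_dualBarrier hne,
    isClosed_epigraph_of_closure_sublevel isOpen_interior hcd.continuousOn
      (hF.closure_sublevel_dualBarrier_subset hK hne), hcd, fun s hs h => ?_⟩,
    hF.barrier.one_le_param, fun s hs h => ?_⟩
  · obtain ⟨-, x, hx, hd, hdd⟩ := hF.exists_dual_derivatives hK hne hs
    obtain ⟨w, hw, h2, h3⟩ := hdd h
    rw [h2, h3]
    exact (neg_le_abs _).trans (hF.selfConcordant.abs_third_le hx w)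
  · obtain ⟨-, x, hx, hd, hdd⟩ := hF.exists_dual_derivatives hK hne hs
    obtain ⟨w, hw, h2, h3⟩ := hdd h
    -- Both sides equal -⟨h, x⟩ = ⟨∇²F(x) w, x⟩, by symmetry and ∇²F(x) x = -∇F(x).
    have e : fderiv ℝ (dualBarrier K F) s h = -fderiv ℝ F x w := by
      have k1 := hF.hessian_self hx w
      rw [fderiv_fderiv_symm (hF.selfConcordant.contDiffAt_two hx), hw] at k1
      rw [hd, ← k1]
      simp
    have k := hF.barrier.sq_fderiv_le x hx w
    rw [iteratedFDeriv_two_diag] at k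
    rw [h2, e, neg_sq]
    exact k

theorem dualBarrier_hessian_pos (hF : IsRegularBarrier K F ν) (hK : ∀ x ∈ K, -x ∈ K → x = 0)
    (hne : (interior (K : Set E)).Nonempty) {s h : StrongDual ℝ E}
    (hs : s ∈ interior (dualCone K : Set (StrongDual ℝ E))) (hh : h ≠ 0) :
    0 < iteratedFDeriv ℝ 2 (dualBarrier K F) s (fun _ => h) := by
  obtain ⟨-, x, hx, -, hdd⟩ := hF.exists_dual_derivatives hK hne hs
  obtain ⟨w, hw, h2, -⟩ := hdd h
  rw [h2]
  refine hF.hessian_pos hK hx ?_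
  rintro rfl
  exact hh (by simpa using hw.symm)

theorem neg_dualGradient_mem_interior (hF : IsRegularBarrier K F ν)
    (hK : ∀ x ∈ K, -x ∈ K → x = 0) (hne : (interior (K : Set E)).Nonempty) {s : StrongDual ℝ E}
    (hs : s ∈ interior (dualCone K : Set (StrongDual ℝ E))) :
    -dualGradient (dualBarrier K F) s ∈ interior (K : Set E) := by
  obtain ⟨-, x, hx, hd, -⟩ := hF.exists_dual_derivatives hK hne hs
  have : dualGradient (dualBarrier K F) s = -x := by
    refine (SeparatingDual.eq_iff_forall_dual_eq (R := ℝ)).2 fun g => ?_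
    rw [apply_dualGradient, hd]
    simp
  rwa [this, neg_neg]

end IsRegularBarrier

/-! ### Asymptotic directions of unbounded sets. -/

section Recession

open Filter Topology

/-- An unbounded set in a finite-dimensional space has a nonzero asymptotic direction. -/
theorem exists_asymptotic_direction {V : Type*} [NormedAddCommGroup V] [NormedSpace ℝ V]
    [FiniteDimensional ℝ V] {S : Set V} (hS : ¬ Bornology.IsBounded S) :
    ∃ d : V, d ≠ 0 ∧ ∃ (u : ℕ → V) (r : ℕ → ℝ), (∀ n, u n ∈ S) ∧ (∀ n, 0 ≤ r n) ∧
      Tendsto r atTop (𝓝 0) ∧ Tendsto (fun n => r n • u n) atTop (𝓝 d) := by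
  have hex : ∀ n : ℕ, ∃ u ∈ S, (n : ℝ) + 1 < ‖u‖ := by
    intro n
    by_contra! h
    exact hS (isBounded_iff_forall_norm_le.2 ⟨_, h⟩)
  choose u hu hun using hex
  have hpos : ∀ n, 0 < ‖u n‖ := fun n => lt_trans (by positivity) (hun n)
  obtain ⟨d, hd, φ, hφ, hlim⟩ := (isCompact_sphere (0 : V) 1).tendsto_subseq
    (x := fun n => ‖u n‖⁻¹ • u n) fun n => by
      rw [mem_sphere_zero_iff_norm, norm_smul, norm_inv, norm_norm,
        inv_mul_cancel₀ (hpos n).ne']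
  refine ⟨d, ?_, u ∘ φ, fun n => ‖u (φ n)‖⁻¹, fun n => hu _, fun n => by positivity, ?_, hlim⟩
  · rintro rfl
    simp at hd
  · have h0 : Tendsto (fun n => ‖u n‖) atTop atTop :=
      tendsto_atTop_mono (fun n => by linarith [hun n]) tendsto_natCast_atTop_atTop
    exact (tendsto_inv_atTop_zero.comp h0).comp hφ.tendsto_atTop

theorem mem_cone_of_asymptotic {V W : Type*} [NormedAddCommGroup V] [NormedSpace ℝ V]
    [NormedAddCommGroup W] [NormedSpace ℝ W] (C : ProperCone ℝ W) (L : V →L[ℝ] W) (a : W)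
    {u : ℕ → V} {r : ℕ → ℝ} {d : V} (hu : ∀ n, L (u n) + a ∈ C) (hr : ∀ n, 0 ≤ r n)
    (hr0 : Tendsto r atTop (𝓝 0)) (hd : Tendsto (fun n => r n • u n) atTop (𝓝 d)) : L d ∈ C := by
  have hlim : Tendsto (fun n => L (r n • u n) + r n • a) atTop (𝓝 (L d + (0 : ℝ) • a)) :=
    ((L.continuous.tendsto d).comp hd).add (hr0.smul_const a)
  rw [zero_smul, add_zero] at hlim
  refine (ProperCone.isClosed C).mem_of_tendsto hlim (Eventually.of_forall fun n => ?_)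
  rw [map_smul, ← smul_add]
  exact ProperCone.smul_mem C (hu n) (hr n)

end Recession

/-! ### The auxiliary problem: strict convexity, boundedness, multipliers. -/

namespace ShiftData

open Set Filter Topology

variable {Ex Ey : Type*}
  [NormedAddCommGroup Ex] [NormedSpace ℝ Ex]
  [NormedAddCommGroup Ey] [NormedSpace ℝ Ey]
  (P : ShiftData Ex Ey)

/-- The linear part of the shifted dual point. -/
noncomputable def dualLin : Ex × Ey × ℝ →L[ℝ] StrongDual ℝ Ex :=
  ((ContinuousLinearMap.snd ℝ Ey ℝ).comp (ContinuousLinearMap.snd ℝ Ex (Ey × ℝ))).smulRight P.c -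
    P.A.flip.comp ((ContinuousLinearMap.fst ℝ Ey ℝ).comp (ContinuousLinearMap.snd ℝ Ex (Ey × ℝ)))

/-- The linear part of `ω`. -/
noncomputable def omegaLin : Ex × Ey × ℝ →L[ℝ] ℝ :=
  -P.c.comp (ContinuousLinearMap.fst ℝ Ex (Ey × ℝ)) +
    P.b.comp ((ContinuousLinearMap.fst ℝ Ey ℝ).comp (ContinuousLinearMap.snd ℝ Ex (Ey × ℝ))) -
    P.ε • (ContinuousLinearMap.snd ℝ Ey ℝ).comp (ContinuousLinearMap.snd ℝ Ex (Ey × ℝ))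

/-- The constraint operator `(x, y, τ) ↦ A x - τ b`. -/
noncomputable def constraint : Ex × Ey × ℝ →L[ℝ] StrongDual ℝ Ey :=
  P.A.comp (ContinuousLinearMap.fst ℝ Ex (Ey × ℝ)) -
    ((ContinuousLinearMap.snd ℝ Ey ℝ).comp (ContinuousLinearMap.snd ℝ Ex (Ey × ℝ))).smulRight P.b

theorem dualLin_apply (h : Ex × Ey × ℝ) : P.dualLin h = h.2.2 • P.c - P.A.flip h.2.1 := rfl

theorem omegaLin_apply (h : Ex × Ey × ℝ) :
    P.omegaLin h = -P.c h.1 + P.b h.2.1 - P.ε * h.2.2 := rfl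

theorem constraint_apply (h : Ex × Ey × ℝ) : P.constraint h = P.A h.1 - h.2.2 • P.b := rfl

theorem dualPt_eq (u : Ex × Ey × ℝ) : P.dualPt u = P.dualLin u + P.sbar := by
  rw [dualLin_apply, dualPt]; abel

theorem omega_eq (u : Ex × Ey × ℝ) : P.omega u = P.omegaLin u + P.τbar := by
  rw [omegaLin_apply, omega]; ring

theorem primalPt_eq (u : Ex × Ey × ℝ) :
    P.primalPt u = ContinuousLinearMap.fst ℝ Ex (Ey × ℝ) u + P.xbar :=
  add_comm _ _

theorem constraint_eq_zero_iff {P : ShiftData Ex Ey} {u : Ex × Ey × ℝ} :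
    P.constraint u = 0 ↔ P.A u.1 = u.2.2 • P.b := by
  rw [constraint_apply, sub_eq_zero]

theorem flip_injective (hA : Function.Surjective P.A) {y : Ey} (hy : P.A.flip y = 0) : y = 0 := by
  refine (SeparatingDual.eq_iff_forall_dual_eq (R := ℝ)).2 fun g => ?_
  obtain ⟨x, rfl⟩ := hA g
  simpa using DFunLike.congr_fun hy x

/-- If τ ≠ 0, then τ c = A* y would put c in the image of A*; if τ = 0, injectivity of A* gives y =
0. -/
theorem eq_zero_of_dualLin_eq_zero (hA : Function.Surjective P.A)
    (hc : P.c ∉ Set.range P.A.flip) {h : Ex × Ey × ℝ} (h1 : h.1 = 0) (h2 : P.dualLin h = 0) :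
    h = 0 := by
  rw [dualLin_apply, sub_eq_zero] at h2
  have ht : h.2.2 = 0 := by
    by_contra ht
    refine hc ⟨h.2.2⁻¹ • h.2.1, ?_⟩
    rw [map_smul, ← h2, inv_smul_smul₀ ht]
  rw [ht, zero_smul] at h2
  exact Prod.ext h1 (Prod.ext (P.flip_injective hA h2.symm) ht)

theorem Phi_eq : P.Phi =
    (fun u => P.F (ContinuousLinearMap.fst ℝ Ex (Ey × ℝ) u + P.xbar)) +
      (fun u => dualBarrier P.K P.F (P.dualLin u + P.sbar)) +
      fun u => -Real.log (P.omegaLin u + P.τbar) := by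
  funext u
  simp only [Phi, primalPt_eq, dualPt_eq, omega_eq, Pi.add_apply, sub_eq_add_neg]

variable [FiniteDimensional ℝ Ex]

theorem dom_eq : P.dom =
    ({u | ContinuousLinearMap.fst ℝ Ex (Ey × ℝ) u + P.xbar ∈ interior (P.K : Set Ex)} ∩
      {u | P.dualLin u + P.sbar ∈ interior (dualCone P.K : Set (StrongDual ℝ Ex))}) ∩
      {u | P.omegaLin u + P.τbar ∈ Ioi (0 : ℝ)} := by
  ext u
  simp only [dom, primalPt_eq, dualPt_eq, omega_eq, mem_inter_iff, mem_ofPred_eq, mem_Ioi,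
    and_assoc]

variable {P} {ν : ℝ}

theorem barrier_Phi (hF : IsRegularBarrier P.K P.F ν) (hK : ∀ x ∈ P.K, -x ∈ P.K → x = 0)
    (hne : (interior (P.K : Set Ex)).Nonempty) :
    IsSelfConcordantBarrier P.dom P.Phi (2 * ν + 1) := by
  rw [dom_eq, Phi_eq, two_mul]
  exact ((hF.barrier.comp_affine _ P.xbar).add
    ((hF.dualBarrier_barrier hK hne).comp_affine P.dualLin P.sbar)).add
    (isSelfConcordantBarrier_neg_log.comp_affine P.omegaLin P.τbar)

theorem strictConvexOn_Phi (hF : IsRegularBarrier P.K P.F ν)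
    (hK : ∀ x ∈ P.K, -x ∈ P.K → x = 0) (hne : (interior (P.K : Set Ex)).Nonempty)
    (hA : Function.Surjective P.A) (hc : P.c ∉ Set.range P.A.flip) :
    StrictConvexOn ℝ P.dom P.Phi := by
  have hsc := (barrier_Phi hF hK hne).selfConcordant
  refine strictConvexOn_of_hessian_pos hsc.isOpen_dom hsc.convexOn.1
    (hsc.contDiffOn.of_le (by norm_num)) fun u hu h hh => ?_
  rw [dom_eq] at hu
  obtain ⟨⟨hu1, hu2⟩, hu3⟩ := hu
  have hD := hF.dualBarrier_barrier hK hne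
  have s1 := hF.selfConcordant.comp_affine (ContinuousLinearMap.fst ℝ Ex (Ey × ℝ)) P.xbar
  have s2 := hD.selfConcordant.comp_affine P.dualLin P.sbar
  have s3 := isSelfConcordantBarrier_neg_log.selfConcordant.comp_affine P.omegaLin P.τbar
  rw [Phi_eq, iteratedFDeriv_add_apply ((s1.add s2).contDiffAt_two ⟨hu1, hu2⟩)
    (s3.contDiffAt_two hu3), iteratedFDeriv_add_apply (s1.contDiffAt_two hu1)
    (s2.contDiffAt_two hu2), add_apply, add_apply]
  have n1 := s1.hessian_nonneg hu1 h
  have n2 := s2.hessian_nonneg hu2 h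
  have n3 := s3.hessian_nonneg hu3 h
  rw [← iteratedFDeriv_two_diag] at n1 n2 n3
  -- Either `F` already sees the direction, or its dual component is nonzero and `F_*` sees it.
  by_cases h1 : h.1 = 0
  · have h2 : P.dualLin h ≠ 0 := fun h2 => hh (P.eq_zero_of_dualLin_eq_zero hA hc h1 h2)
    have k := hF.dualBarrier_hessian_pos hK hne hu2 h2
    rw [← iteratedFDeriv_comp_affine (n := 3) hD.selfConcordant.isOpen_dom
      hD.selfConcordant.contDiffOn P.dualLin P.sbar hu2 (by norm_num) (fun _ => h)] at k
    linarith
  · have k : 0 < iteratedFDeriv ℝ 2 P.F (ContinuousLinearMap.fst ℝ Ex (Ey × ℝ) u + P.xbar)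
        (fun _ => ContinuousLinearMap.fst ℝ Ex (Ey × ℝ) h) := by
      rw [iteratedFDeriv_two_diag]
      exact hF.hessian_pos hK hu1 h1
    have e := iteratedFDeriv_comp_affine (n := 3) hF.selfConcordant.isOpen_dom
      hF.selfConcordant.contDiffOn (ContinuousLinearMap.fst ℝ Ex (Ey × ℝ)) P.xbar hu1
      (i := 2) (by norm_num) (fun _ => h)
    rw [← e] at k
    linarith

theorem zero_mem_feasible (hx : P.xbar ∈ interior (P.K : Set Ex))
    (hs : P.sbar ∈ interior (dualCone P.K : Set (StrongDual ℝ Ex))) (hτ : 0 < P.τbar) :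
    (0 : Ex × Ey × ℝ) ∈ P.feasible := by
  refine ⟨?_, by simp⟩
  rw [dom_eq]
  simpa using ⟨⟨hx, hs⟩, hτ⟩

theorem isBounded_feasible [FiniteDimensional ℝ Ey] (hF : IsRegularBarrier P.K P.F ν)
    (hA : Function.Surjective P.A) (hc : P.c ∉ Set.range P.A.flip) {x : Ex} {s : StrongDual ℝ Ex}
    {y : Ey} (hfeas : IsStrictlyFeasible P.K P.A P.b P.c x s y) (hε : 0 < P.ε) :
    Bornology.IsBounded P.feasible := by
  by_contra hunb
  obtain ⟨d, hd0, u, r, hu, hr, hr0, hlim⟩ := exists_asymptotic_direction hunb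
  have hud : ∀ n, u n ∈ P.dom := fun n => (hu n).1
  simp only [dom_eq] at hud
  have hdx : d.1 ∈ P.K := mem_cone_of_asymptotic P.K (ContinuousLinearMap.fst ℝ Ex (Ey × ℝ))
    P.xbar (fun n => interior_subset (hud n).1.1) hr hr0 hlim
  have hq : P.dualLin d ∈ dualCone P.K := mem_cone_of_asymptotic (dualCone P.K) P.dualLin P.sbar
    (fun n => interior_subset (hud n).1.2) hr hr0 hlim
  have hω : 0 ≤ P.omegaLin d := by
    refine ge_of_tendsto (((P.omegaLin.continuous.tendsto d).comp hlim).add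
      (hr0.mul_const P.τbar) |>.trans (by simp)) (Eventually.of_forall fun n => ?_)
    have h1 : 0 < P.omegaLin (u n) + P.τbar := (hud n).2
    simp only [Function.comp_apply, map_smul, smul_eq_mul, ← mul_add]
    exact mul_nonneg (hr n) h1.le
  have hcon : P.A d.1 = d.2.2 • P.b := by
    rw [← constraint_eq_zero_iff]
    refine tendsto_nhds_unique ((P.constraint.continuous.tendsto d).comp hlim)
      (tendsto_const_nhds.congr fun n => ?_)
    rw [Function.comp_apply, map_smul, constraint_eq_zero_iff.2 (hu n).2, smul_zero]
  obtain ⟨dx, dy, t⟩ := d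
  simp only [omegaLin_apply] at hω hcon hdx
  have hqx := mem_dualCone.1 hq dx hdx
  have hpair : ∀ z : Ex, P.dualLin (dx, dy, t) z = t * P.c z - P.A z dy := fun z => rfl
  rw [hpair, hcon] at hqx
  simp only [smul_apply, smul_eq_mul] at hqx
  have hAx := hfeas.primal_eq
  have hcs : ∀ z : Ex, P.c z = s z + P.A z y := fun z => by
    rw [← hfeas.dual_eq]; rfl
  rcases lt_trichotomy t 0 with ht | ht | ht
  -- For t < 0, adding -t times the strictly feasible pair gives a primal point in the kernel of A
  -- and a dual point in the image of A*. Their pairing is zero, but both are interior.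
  · have hx' : dx + (-t) • x ∈ interior (P.K : Set Ex) :=
      add_mem_interior_cone hdx (smul_mem_interior_cone (neg_pos.2 ht) hfeas.primal_mem)
    have hs' : P.dualLin (dx, dy, t) + (-t) • s ∈
        interior (dualCone P.K : Set (StrongDual ℝ Ex)) :=
      add_mem_interior_cone hq (smul_mem_interior_cone (neg_pos.2 ht) hfeas.dual_mem)
    have hA' : P.A (dx + (-t) • x) = 0 := by
      rw [map_add, map_smul, hcon, hAx]; module
    have hpos := pos_of_mem_interior_dualCone hs' (interior_subset hx')
      (hF.ne_zero_of_mem_interior hx')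
    rw [add_apply, hpair, hcs, hA', smul_apply] at hpos
    simp at hpos
  -- For t = 0, the nonnegative numbers ⟨s, dx⟩ and ⟨q, x⟩ add up to ⟨c, dx⟩ - ⟨b, dy⟩ ≤ 0, so both
  -- vanish.
  · subst ht
    rw [zero_smul] at hcon
    have hqx' := mem_dualCone.1 hq x (interior_subset hfeas.primal_mem)
    have e1 := hcs dx
    rw [hcon, zero_apply, add_zero] at e1
    have e2 := hpair x
    rw [hAx, zero_mul, zero_sub] at e2
    have hs1 := mem_dualCone.1 (interior_subset hfeas.dual_mem : s ∈ dualCone P.K) dx hdx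
    have hdx0 : dx = 0 := by
      by_contra h0
      have := pos_of_mem_interior_dualCone hfeas.dual_mem hdx h0
      linarith
    have hq0 : P.dualLin (dx, dy, 0) = 0 := by
      by_contra h0
      have := pos_of_mem_dualCone_of_mem_interior hq h0 hfeas.primal_mem
      linarith
    exact hd0 (P.eq_zero_of_dualLin_eq_zero hA hc hdx0 hq0)
  -- For t > 0, 0 ≤ ⟨q, dx⟩ = t (⟨c, dx⟩ - ⟨b, dy⟩) ≤ -ε t².
  · nlinarith [mul_pos hε ht, mul_pos ht (mul_pos hε ht)]

theorem existsUnique_isSolution [FiniteDimensional ℝ Ey] (hF : IsRegularBarrier P.K P.F ν)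
    (hK : ∀ x ∈ P.K, -x ∈ P.K → x = 0) (hA : Function.Surjective P.A)
    (hc : P.c ∉ Set.range P.A.flip) {x : Ex} {s : StrongDual ℝ Ex} {y : Ey}
    (hfeas : IsStrictlyFeasible P.K P.A P.b P.c x s y) (hε : 0 < P.ε)
    (hx : P.xbar ∈ interior (P.K : Set Ex))
    (hs : P.sbar ∈ interior (dualCone P.K : Set (StrongDual ℝ Ex))) (hτ : 0 < P.τbar) :
    ∃! u, P.IsSolution u := by
  have hsc := (barrier_Phi hF hK ⟨_, hx⟩).selfConcordant
  have hlin : {u | P.A u.1 = u.2.2 • P.b} = P.constraint ⁻¹' {0} := by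
    ext u; exact constraint_eq_zero_iff.symm
  have hfeq : P.feasible = P.dom ∩ P.constraint ⁻¹' {0} := by
    rw [← hlin]; rfl
  have hconv : Convex ℝ P.feasible := by
    have h : Convex ℝ (P.constraint ⁻¹' {0}) :=
      (convex_singleton (0 : StrongDual ℝ Ey)).linear_preimage P.constraint.toLinearMap
    rw [hfeq]
    exact hsc.convexOn.1.inter h
  have hstrict : StrictConvexOn ℝ P.feasible P.Phi :=
    (strictConvexOn_Phi hF hK ⟨_, hx⟩ hA hc).subset (fun u hu => hu.1) hconv
  have h0 := zero_mem_feasible (P := P) hx hs hτ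
  -- The origin is feasible, so its sublevel set is nonempty; the closed epigraph of `Φ` and
  -- boundedness make it compact.
  set S : Set (Ex × Ey × ℝ) := {u | u ∈ P.feasible ∧ P.Phi u ≤ P.Phi 0} with hS
  have hclosed : IsClosed S := by
    have e : S = {u | u ∈ P.dom ∧ P.Phi u ≤ P.Phi 0} ∩ P.constraint ⁻¹' {0} := by
      rw [hS, hfeq]; ext u; simp only [mem_ofPred_eq, mem_inter_iff]; tauto
    rw [e]
    exact (isClosed_of_closure_subset
      (closure_sublevel_subset_of_isClosed_epigraph hsc.isClosed_epigraph _)).inter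
      (isClosed_singleton.preimage P.constraint.continuous)
  have hcomp : IsCompact S := Metric.isCompact_of_isClosed_isBounded hclosed
    ((isBounded_feasible hF hA hc hfeas hε).subset fun u hu => hu.1)
  obtain ⟨u, hu, hmin⟩ := hcomp.exists_isMinOn ⟨0, h0, le_rfl⟩
    (hsc.contDiffOn.continuousOn.mono fun u hu => hu.1.1)
  have hsol : P.IsSolution u := by
    refine ⟨hu.1, fun v hv => ?_⟩
    rcases le_total (P.Phi v) (P.Phi 0) with h | h
    · exact hmin ⟨hv, h⟩
    · exact hu.2.trans h
  exact ⟨u, hsol, fun v hv => hstrict.eq_of_isMinOn hv.2 hsol.2 hv.1 hsol.1⟩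

theorem hasFDerivAt_lagrangian (hF : IsRegularBarrier P.K P.F ν)
    (hK : ∀ x ∈ P.K, -x ∈ P.K → x = 0) {u : Ex × Ey × ℝ} (hu : u ∈ P.dom) (lam : Ey) :
    ∃ Λ : StrongDual ℝ (Ex × Ey × ℝ), HasFDerivAt (fun v => P.lagrangian v lam) Λ u ∧
      ∀ h, Λ h = (P.gradPrimal u + (P.omega u)⁻¹ • P.c - P.A.flip lam) h.1 +
        (-P.A (P.gradDual u) - (P.omega u)⁻¹ • P.b) h.2.1 +
        (P.c (P.gradDual u) + (P.omega u)⁻¹ * P.ε + P.b lam) * h.2.2 := by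
  have hne : (interior (P.K : Set Ex)).Nonempty := ⟨_, hu.1⟩
  have hD := hF.dualBarrier_barrier hK hne
  have hω : P.omegaLin u + P.τbar ≠ 0 := by rw [← omega_eq]; exact hu.2.2.ne'
  have k1 : HasFDerivAt P.F (P.gradPrimal u)
      (ContinuousLinearMap.fst ℝ Ex (Ey × ℝ) u + P.xbar) := by
    rw [gradPrimal, ← primalPt_eq]
    exact (hF.selfConcordant.differentiableAt hu.1).hasFDerivAt
  have k2 : HasFDerivAt (dualBarrier P.K P.F) (fderiv ℝ (dualBarrier P.K P.F) (P.dualPt u))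
      (P.dualLin u + P.sbar) := by
    rw [← dualPt_eq]
    exact (hD.selfConcordant.differentiableAt hu.2.1).hasFDerivAt
  have d1 := k1.comp u
    ((ContinuousLinearMap.fst ℝ Ex (Ey × ℝ)).hasFDerivAt.add_const P.xbar)
  have d2 := k2.comp u (P.dualLin.hasFDerivAt.add_const P.sbar)
  have d3 := ((P.omegaLin.hasFDerivAt (x := u)).add_const P.τbar).log hω |>.neg
  rw [← omega_eq] at d3
  have d4 := (P.constraint.hasFDerivAt (x := u)).neg.clm_apply (hasFDerivAt_const lam u)
  have hfun : (fun v => P.lagrangian v lam) =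
      ((fun u => P.F (ContinuousLinearMap.fst ℝ Ex (Ey × ℝ) u + P.xbar)) +
      (fun u => dualBarrier P.K P.F (P.dualLin u + P.sbar)) +
      fun u => -Real.log (P.omegaLin u + P.τbar)) + fun v => (-P.constraint v) lam := by
    funext v
    rw [lagrangian, Phi_eq, Pi.add_apply _ (fun v => (-P.constraint v) lam), constraint_apply,
      neg_sub]
  rw [hfun]
  refine ⟨_, ((d1.add d2).add d3).add d4, fun h => ?_⟩
  have e : fderiv ℝ (dualBarrier P.K P.F) (P.dualPt u) (P.dualLin h) =
      h.2.2 * P.c (P.gradDual u) - P.A (P.gradDual u) h.2.1 :=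
    (apply_dualGradient (dualBarrier P.K P.F) (P.dualPt u) (P.dualLin h)).symm
  simp only [add_apply, ContinuousLinearMap.comp_apply, e, neg_apply, smul_apply, sub_apply,
    ContinuousLinearMap.flip_apply, omegaLin_apply, constraint_apply,
    ContinuousLinearMap.coe_fst', smul_eq_mul, zero_apply, map_zero]
  ring

/-- The Lagrange function is convex on an open domain, so minimality amounts to a vanishing
differential, whose x, y and τ blocks are the three equations. -/
theorem isStationary_iff_isMultiplier (hF : IsRegularBarrier P.K P.F ν)
    (hK : ∀ x ∈ P.K, -x ∈ P.K → x = 0) {u : Ex × Ey × ℝ} (hu : u ∈ P.dom) (lam : Ey) :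
    P.IsMultiplier u lam ↔ P.IsStationary u lam := by
  obtain ⟨Λ, hΛ, hΛh⟩ := hasFDerivAt_lagrangian hF hK hu lam
  have hsc := (barrier_Phi hF hK ⟨_, hu.1⟩).selfConcordant
  constructor
  · intro hmin
    have h0 : Λ = 0 := (hmin.isLocalMin (hsc.isOpen_dom.mem_nhds hu)).hasFDerivAt_eq_zero hΛ
    subst h0
    refine ⟨?_, ?_, ?_⟩
    · ext h
      simpa using (hΛh (h, 0, 0)).symm
    · ext k
      simpa using (hΛh (0, k, 0)).symm
    · simpa using (hΛh (0, 0, 1)).symm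
  · rintro ⟨h1, h2, h3⟩
    have h0 : Λ = 0 := by
      refine ContinuousLinearMap.ext fun h => ?_
      rw [hΛh, h1, h2, h3]
      simp
    have hconv : ConvexOn ℝ P.dom (fun v => P.lagrangian v lam) := by
      have hlin : ConvexOn ℝ P.dom
          (-(((ContinuousLinearMap.apply ℝ ℝ lam).comp P.constraint :
            Ex × Ey × ℝ →L[ℝ] ℝ) : Ex × Ey × ℝ →ₗ[ℝ] ℝ)) :=
        LinearMap.convexOn _ hsc.convexOn.1
      refine (hsc.convexOn.add hlin).congr fun v _ => ?_
      simp [lagrangian, constraint_apply]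
    intro v hv
    have := add_fderiv_le_of_convexOn hconv hu hv hΛ.differentiableAt
    rw [hΛ.fderiv, h0] at this
    simpa using this

theorem exists_isMultiplier [FiniteDimensional ℝ Ey] (hF : IsRegularBarrier P.K P.F ν)
    (hK : ∀ x ∈ P.K, -x ∈ P.K → x = 0) (hA : Function.Surjective P.A) {u : Ex × Ey × ℝ}
    (hu : P.IsSolution u) : ∃ lam, P.IsMultiplier u lam := by
  have hdom := hu.1.1
  have hsc := (barrier_Phi hF hK ⟨_, hdom.1⟩).selfConcordant
  have hd := hsc.differentiableAt hdom
  have hker : ∀ h, P.constraint h = 0 → fderiv ℝ P.Phi u h = 0 := by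
    intro h hh
    have hline : Continuous fun t : ℝ => u + t • h := by fun_prop
    have h1 : HasDerivAt (fun t : ℝ => P.Phi (u + t • h)) (fderiv ℝ P.Phi u h) 0 := by
      have := hasDerivAt_comp_line (f := P.Phi) (x := u) (h := h) (t := 0) (by simpa using hd)
      simpa using this
    have hloc : IsLocalMin (fun t : ℝ => P.Phi (u + t • h)) 0 := by
      filter_upwards [hline.continuousAt.eventually_mem (x := 0)
        (by simpa using hsc.isOpen_dom.mem_nhds hdom)] with t ht
      have hmem : u + t • h ∈ P.feasible := ⟨ht, by
        rw [← constraint_eq_zero_iff, map_add, map_smul, hh,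
          constraint_eq_zero_iff.2 hu.1.2, smul_zero, add_zero]⟩
      simpa using hu.2 hmem
    exact hloc.hasDerivAt_eq_zero h1
  obtain ⟨ρ, hρ⟩ := (P.A : Ex →ₗ[ℝ] StrongDual ℝ Ey).exists_rightInverse_of_surjective
    (LinearMap.range_eq_top.2 hA)
  have hρ' : ∀ g, P.A (ρ g) = g := fun g => DFunLike.congr_fun hρ g
  -- The right inverse ρ of A lifts any value of the constraint to a vector (ρ g, 0, 0), through
  -- which the differential of `Φ` factors.
  let ℓ : StrongDual ℝ Ey →L[ℝ] ℝ := LinearMap.toContinuousLinearMap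
    ((fderiv ℝ P.Phi u : Ex × Ey × ℝ →ₗ[ℝ] ℝ) ∘ₗ LinearMap.inl ℝ Ex (Ey × ℝ) ∘ₗ ρ)
  have hfac : ∀ h, fderiv ℝ P.Phi u h = ℓ (P.constraint h) := by
    intro h
    have hz : P.constraint (h - (ρ (P.constraint h), 0, 0)) = 0 := by
      rw [map_sub, P.constraint_apply (ρ (P.constraint h), 0, 0), hρ']
      simp
    have := hker _ hz
    rw [map_sub, sub_eq_zero] at this
    exact this
  -- ℓ is linear, so its gradient at any point represents it as a vector of `Ey`; the base point 0
  -- is immaterial.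
  refine ⟨dualGradient ℓ 0, ?_⟩
  have hlam : ∀ g : StrongDual ℝ Ey, g (dualGradient ℓ 0) = ℓ g := fun g => by
    rw [apply_dualGradient, ContinuousLinearMap.fderiv]
  intro v hv
  have h1 := add_fderiv_le_of_convexOn hsc.convexOn hdom hv hd
  rw [hfac, map_sub, constraint_eq_zero_iff.2 hu.1.2, sub_zero, ← hlam, constraint_apply] at h1
  have h2 : (u.2.2 • P.b - P.A u.1) = 0 := by rw [hu.1.2, sub_self]
  simp only [mem_ofPred_eq, lagrangian, h2, zero_apply, add_zero]
  simp only [sub_apply] at h1 ⊢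
  linarith

end ShiftData

end InfeasibleStart

/-! ### The main theorem. -/

theorem mainTheorem4 {Ex Ey : Type*}
    [NormedAddCommGroup Ex] [NormedSpace ℝ Ex] [FiniteDimensional ℝ Ex]
    [NormedAddCommGroup Ey] [NormedSpace ℝ Ey] [FiniteDimensional ℝ Ey]
    (P : InfeasibleStart.ShiftData Ex Ey) (ν : ℝ)
    (hK : ∀ x ∈ P.K, -x ∈ P.K → x = 0)
    (hF : InfeasibleStart.IsRegularBarrier P.K P.F ν)
    (hA : Function.Surjective P.A)
    (hc : P.c ∉ Set.range P.A.flip)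
    (hfeas : ∃ (x : Ex) (s : StrongDual ℝ Ex) (y : Ey),
      InfeasibleStart.IsStrictlyFeasible P.K P.A P.b P.c x s y)
    (hε : 0 < P.ε)
    (hx : P.xbar ∈ interior (P.K : Set Ex))
    (hs : P.sbar ∈ interior (InfeasibleStart.dualCone P.K : Set (StrongDual ℝ Ex)))
    (hτ : 0 < P.τbar) :
    InfeasibleStart.IsSelfConcordantBarrier P.dom P.Phi (2 * ν + 1) ∧
    (∃! u, P.IsSolution u) ∧
    ∀ u, P.IsSolution u →
      (∃! lam, P.IsMultiplier u lam) ∧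
      ∀ lam, P.IsMultiplier u lam →
        0 < P.omega u ∧
        P.IsStationary u lam ∧
        InfeasibleStart.IsStrictlyFeasible P.K P.A P.b P.c
          (P.xEps u) (P.sEps u) (P.yEps u lam) ∧
        P.sEps u (P.xEps u) = P.c (P.xEps u) - P.b (P.yEps u lam) ∧
        P.c (P.xEps u) - P.b (P.yEps u lam) = P.ε := by
  open InfeasibleStart ShiftData in
  have hne : (interior (P.K : Set Ex)).Nonempty := ⟨_, hx⟩
  obtain ⟨x, s, y, hxsy⟩ := hfeas
  refine ⟨barrier_Phi hF hK hne, existsUnique_isSolution hF hK hA hc hxsy hε hx hs hτ,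
    fun u hu => ?_⟩
  have hiff := fun lam => isStationary_iff_isMultiplier hF hK hu.1.1 lam
  constructor
  · obtain ⟨lam, hlam⟩ := exists_isMultiplier hF hK hA hu
    refine ⟨lam, hlam, fun μ hμ => ?_⟩
    have h1 := ((hiff lam).1 hlam).eq_x
    have h2 := ((hiff μ).1 hμ).eq_x
    rw [← sub_eq_zero]
    -- The x-equation determines A* lam, and A* is injective.
    refine P.flip_injective hA ?_
    rw [map_sub, ← sub_eq_zero.1 h1, ← sub_eq_zero.1 h2, sub_self]
  intro lam hlam
  obtain ⟨⟨hu1, hu2, hω⟩, -⟩ := hu.1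
  have hst := (hiff lam).1 hlam
  have hω' := hω.ne'
  have hxe : P.A (P.xEps u) = P.b := by
    have h := hst.eq_y
    rw [sub_eq_zero, neg_eq_iff_eq_neg] at h
    rw [xEps, map_neg, map_smul, h, smul_neg, neg_neg, smul_inv_smul₀ hω']
  have hse : P.sEps u + P.A.flip (P.yEps u lam) = P.c := by
    have h := hst.eq_x
    rw [sub_eq_zero] at h
    rw [sEps, yEps, map_smul, ← h, smul_add, smul_inv_smul₀ hω']
    abel
  refine ⟨hω, hst, ⟨?_, hxe, ?_, hse⟩, ?_, ?_⟩
  · rw [xEps, ← smul_neg]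
    exact smul_mem_interior_cone hω (hF.neg_dualGradient_mem_interior hK hne hu2)
  · have h : P.sEps u = P.omega u • -P.gradPrimal u := (smul_neg _ _).symm
    rw [h]
    exact smul_mem_interior_cone hω (hF.neg_fderiv_mem_interior_dualCone hK hu1)
  · have h := DFunLike.congr_fun hse (P.xEps u)
    rw [add_apply, ContinuousLinearMap.flip_apply, hxe] at h
    linarith
  -- The τ-equation multiplied by ω is exactly the gap identity.
  · have h := hst.eq_τ
    rw [xEps, yEps, map_neg, map_smul, map_smul, smul_eq_mul, smul_eq_mul]
    field_simp at h
    linarith
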